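/- **Language.** Fix disjoint infinite sets of actor classes $C$, method names $m$, field names $f$ and variables $x$; the variables are totally ordered (as $\mathbb N$), and `this` is a special variable. Expressions and processes are $$E ::= f \mid x \mid \mathtt{new}\,C(\widetilde E),\qquad P ::= 0 \mid (f\leftarrow E).P \mid \mathtt{let}\ x=E\ \mathtt{in}\ P \mid x!m(\widetilde E).P \mid [E=E]\,P;P \mid P+P,$$ processes being identified up to renaming of `let`-bound variables. A program consists of a main process, a finite set of method definitions $C.m(\widetilde x)=P$, at most one for each pair $(C,m)$, and a tuple $\mathrm{fields}(C)$ of field names for every class $C$. In every $\mathtt{new}\,C(\widetilde E)$ the lengths of $\widetilde E$ and $\mathrm{fields}(C)$ agree, and the bodies of the methods of $C$ mention only fields of $C$. The program is in $\mathtt{Actor}^{ro}_{ba}$ if it contains no field update $(f\leftarrow E)$ and `new` occurs only in the main process. **Semantics.** Every class has infinitely many actor names $C_0,C_1,\dots$, and there is a root actor name $\aleph$ whose class is not a class of the program and has no fields and no methods. Values are variables and actor names. A configuration is a set of terms $A\triangleright(P,\varphi,q)$, at most one for each actor name $A$, where $P$ is a process (possibly containing actor names), $\varphi$ maps the fields of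 $A$ to values, and $q$ is a queue of messages $m(\widetilde U)$ with $\widetilde U$ values. Expressions of an actor with state $\varphi$ are evaluated from left to right: a value evaluates to itself, $f$ to $\varphi(f)$, and $\mathtt{new}\,C(\widetilde E)$ to the first unused actor name $A$ of $C$, adding $A\triangleright(0,[\mathrm{fields}(C)\mapsto\widetilde U],\varepsilon)$ to the configuration, where $\widetilde U$ are the values of $\widetilde E$. In a transition one actor $A\triangleright(P,\varphi,q)$ makes one step: - $P=(f\leftarrow E).P'$: set $\varphi(f)$ to the value of $E$ and continue with $P'$; - $P=\mathtt{let}\ x=E\ \mathtt{in}\ P'$: continue with $P'\{U/x\}$, where $U$ is the value of $E$; - $P=B!m(\widetilde E).P'$ with $B$ an actor name of the configuration (possibly $A$): append $m(\widetilde U)$, with $\widetilde U$ the values of $\widetilde E$, to the queue of $B$ and continue with $P'$; - $P=[E=E']\,P';P''$: continue with $P'$ if the values of $E,E'$ are equal, and with $P''$ otherwise; - $P=P'+P''$: continue with $P'$ or with $P''$; - $P=0$, $q=m(\widetilde U)\cdot q'$, $A$ is of class $C$, $C.m(\widetilde x)=P'$ is a definition and $|\widetilde x|=|\widetilde U|$: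 remove the message and continue with the body $P'$ in which simultaneously `this` is replaced by $A$, $\widetilde x$ by $\widetilde U$, and the remaining free variables, in increasing order, by the least variables that occur neither in the configuration nor in the program. The transition system $(\mathcal S,\to)$ of the program has as states the configurations reachable from $\aleph\triangleright(\text{main process},\varnothing,\varepsilon)$. The program is *free of run-time type errors* if in no reachable configuration an actor of a class $C$ is about to execute an invocation $x!m(\widetilde E).P$ whose target is a variable rather than an actor name, or has in its queue a message $m(\widetilde U)$ for which there is no definition $C.m(\widetilde x)=P$ with $|\widetilde x|=|\widetilde U|$. **Ordering.** A renaming is a function $\rho$ from the variables not free in the main process to values. Write $\rho\doteq\rho'$ if for all $x,y$: $\rho(x)=\rho(y)$ iff $\rho'(x)=\rho'(y)$; and $\rho(x)=\rho'(x)$ whenever $\rho(x)$ or $\rho'(x)$ is an actor name or a free variable of the main process. Let $\simeq$ be the least relation such that $P\rho\simeq P\rho'$ and $m(\rho(x_1),\dots,\rho(x_k))\simeq m(\rho'(x_1),\dots,\rho'(x_k))$ whenever $\rho\doteq\rho'$, for all (run-time) processes $P$, method names $m$, and variables $x_1,\dots,x_k$ not free in the main process. Here $P\rho$ is obtained by substituting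 $\rho(x)$ for the free occurrences of each $x$ not free in the main process. For queues, $q\le q'$ if $q$ is related by $\simeq$, message by message, to a (scattered) subword of $q'$. For configurations, $S\preceq S'$ if $S$ and $S'$ have the same actor names and, for every such $A$ with $A\triangleright(P,\varphi,q)$ in $S$ and $A\triangleright(P',\varphi',q')$ in $S'$, one has $P\simeq P'$, $\varphi=\varphi'$ and $q\le q'$. **Theorem.** Let $(\mathcal S,\to)$ be the transition system of a program of $\mathtt{Actor}^{ro}_{ba}$ that is free of run-time type errors. Then $(\mathcal S,\to,\preceq)$ is a well-structured transition system, that is: 1. every state has finitely many immediate successors; 2. $\preceq$ is reflexive and transitive, and for every infinite sequence $S_1,S_2,\dots$ of states there are $i<j$ with $S_i\preceq S_j$; 3. if $S_1\preceq S_1'$ and $S_1\to S_2$, then there is a state $S_2'$ with $S_1'\to^* S_2'$ and $S_2\preceq S_2'$. -/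

import Mathlib

namespace ActorLang

/-! ### Names and values -/

/-- Actor classes. -/
abbrev ClassName := ℕ

/-- Method names. -/
abbrev MethodName := ℕ

/-- Field names. -/
abbrev FieldName := ℕ

/-- Variables: an infinite set, totally ordered so that the least unused ones can be taken. -/
abbrev Var := ℕ

/-- The special variable `this`. -/
def this : Var := 0

/-- Actor names: the root, which belongs to a class of its own that no program can mention, and
for every class `C` an infinite, totally ordered supply of names `named C 0, named C 1, ...`. -/
inductive ActorName : Type
  | root : ActorName
  | named (C : ClassName) (i : ℕ) : ActorName
  deriving DecidableEq

/-- Values: variables and actor names. -/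
inductive Value : Type
  | var (x : Var) : Value
  | act (A : ActorName) : Value
  deriving DecidableEq

/-! ### Syntax

Processes are taken up to renaming of bound variables: an occurrence of a `let`-bound variable is
a de Bruijn index, every other occurrence carries its name. `Proc V n` consists of the processes
with names in `V` that may refer to `n` enclosing binders. Source terms have `V = Var`, run-time
terms, in which actor names may occur too, have `V = Value`; closed terms have `n = 0`. -/

/-- An occurrence of a name below `n` binders. -/
inductive Name (V : Type) (n : ℕ) : Type
  | bound (i : Fin n) : Name V n
  | free (v : V) : Name V n

/-- Expressions `E ::= f | x | new C(E, ..., E)`. -/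
inductive Expr (V : Type) (n : ℕ) : Type
  | field (f : FieldName) : Expr V n
  | name (x : Name V n) : Expr V n
  | new (C : ClassName) (Es : List (Expr V n)) : Expr V n

/-- Processes `P ::= 0 | (f <- E).P | let x = E in P | x!m(E, ..., E).P | [E = E] P; P | P + P`. -/
inductive Proc (V : Type) : ℕ → Type
  | nil {n : ℕ} : Proc V n
  | upd {n : ℕ} (f : FieldName) (E : Expr V n) (P : Proc V n) : Proc V n
  | letIn {n : ℕ} (E : Expr V n) (P : Proc V (n + 1)) : Proc V n
  | send {n : ℕ} (x : Name V n) (m : MethodName) (Es : List (Expr V n)) (P : Proc V n) : Proc V n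
  | cond {n : ℕ} (E E' : Expr V n) (P Q : Proc V n) : Proc V n
  | plus {n : ℕ} (P Q : Proc V n) : Proc V n

/-! ### Substitution -/

/-- Weakening of a name by one new innermost binder. -/
def Name.shift {V : Type} {n : ℕ} : Name V n → Name V (n + 1)
  | .bound i => .bound i.succ
  | .free v => .free v

/-- A substitution pushed below one binder. -/
def Name.lift {V W : Type} {n k : ℕ} (s : Name V n → Name W k) :
    Name V (n + 1) → Name W (k + 1)
  | .bound i => Fin.cases (.bound 0) (fun j => (s (.bound j)).shift) i
  | .free v => (s (.free v)).shift

mutual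
/-- Simultaneous substitution of names in an expression. -/
def Expr.subst {V W : Type} {n k : ℕ} (s : Name V n → Name W k) : Expr V n → Expr W k
  | .field f => .field f
  | .name x => .name (s x)
  | .new C Es => .new C (Expr.substList s Es)
/-- Simultaneous substitution of names in a tuple of expressions. -/
def Expr.substList {V W : Type} {n k : ℕ} (s : Name V n → Name W k) :
    List (Expr V n) → List (Expr W k)
  | [] => []
  | E :: Es => Expr.subst s E :: Expr.substList s Es
end

/-- Simultaneous (capture-avoiding) substitution of names in a process. -/
def Proc.subst {V W : Type} : {n : ℕ} → Proc V n → {k : ℕ} → (Name V n → Name W k) → Proc W k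
  | _, .nil, _, _ => .nil
  | _, .upd f E P, _, s => .upd f (E.subst s) (P.subst s)
  | _, .letIn E P, _, s => .letIn (E.subst s) (P.subst (Name.lift s))
  | _, .send x m Es P, _, s => .send (s x) m (Expr.substList s Es) (P.subst s)
  | _, .cond E E' P Q, _, s => .cond (E.subst s) (E'.subst s) (P.subst s) (Q.subst s)
  | _, .plus P Q, _, s => .plus (P.subst s) (Q.subst s)

/-- The substitution of names that replaces the free names according to `σ`. -/
def Name.rename {V W : Type} {n : ℕ} (σ : V → W) : Name V n → Name W n
  | .bound i => .bound i
  | .free v => .free (σ v)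

/-- The process in which every free name `v` is replaced by `σ v`. -/
def Proc.rename {V W : Type} {n : ℕ} (σ : V → W) (P : Proc V n) : Proc W n :=
  P.subst (Name.rename σ)

/-- The substitution of the value `U` for the only bound variable. -/
def Name.open1 {V : Type} (U : V) : Name V 1 → Name V 0
  | .bound _ => .free U
  | .free v => .free v

/-- The body of a `let` in which the bound variable is replaced by `U`. -/
def Proc.open1 {V : Type} (U : V) (P : Proc V 1) : Proc V 0 :=
  P.subst (Name.open1 U)

/-! ### Occurrences -/

/-- The free name of an occurrence. -/
def Name.fv {V : Type} {n : ℕ} : Name V n → Finset V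
  | .bound _ => ∅
  | .free v => {v}

mutual
/-- Free names of an expression. -/
def Expr.fv {V : Type} [DecidableEq V] {n : ℕ} : Expr V n → Finset V
  | .field _ => ∅
  | .name x => x.fv
  | .new _ Es => Expr.fvList Es
/-- Free names of a tuple of expressions. -/
def Expr.fvList {V : Type} [DecidableEq V] {n : ℕ} : List (Expr V n) → Finset V
  | [] => ∅
  | E :: Es => Expr.fv E ∪ Expr.fvList Es
end

/-- Free names of a process. -/
def Proc.fv {V : Type} [DecidableEq V] : {n : ℕ} → Proc V n → Finset V
  | _, .nil => ∅
  | _, .upd _ E P => E.fv ∪ P.fv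
  | _, .letIn E P => E.fv ∪ P.fv
  | _, .send x _ Es P => x.fv ∪ Expr.fvList Es ∪ P.fv
  | _, .cond E E' P Q => E.fv ∪ E'.fv ∪ P.fv ∪ Q.fv
  | _, .plus P Q => P.fv ∪ Q.fv

mutual
/-- Field names occurring in an expression. -/
def Expr.fieldNames {V : Type} {n : ℕ} : Expr V n → Finset FieldName
  | .field f => {f}
  | .name _ => ∅
  | .new _ Es => Expr.fieldNamesList Es
/-- Field names occurring in a tuple of expressions. -/
def Expr.fieldNamesList {V : Type} {n : ℕ} : List (Expr V n) → Finset FieldName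
  | [] => ∅
  | E :: Es => Expr.fieldNames E ∪ Expr.fieldNamesList Es
end

/-- Field names occurring in a process. -/
def Proc.fieldNames {V : Type} : {n : ℕ} → Proc V n → Finset FieldName
  | _, .nil => ∅
  | _, .upd f E P => {f} ∪ E.fieldNames ∪ P.fieldNames
  | _, .letIn E P => E.fieldNames ∪ P.fieldNames
  | _, .send _ _ Es P => Expr.fieldNamesList Es ∪ P.fieldNames
  | _, .cond E E' P Q => E.fieldNames ∪ E'.fieldNames ∪ P.fieldNames ∪ Q.fieldNames
  | _, .plus P Q => P.fieldNames ∪ Q.fieldNames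

mutual
/-- In every subexpression `new C(E, ..., E)` there are as many arguments as fields of `C`. -/
def Expr.NewArity {V : Type} {n : ℕ} (fields : ClassName → List FieldName) : Expr V n → Prop
  | .field _ => True
  | .name _ => True
  | .new C Es => Es.length = (fields C).length ∧ Expr.NewArityList fields Es
/-- The same for a tuple of expressions. -/
def Expr.NewArityList {V : Type} {n : ℕ} (fields : ClassName → List FieldName) :
    List (Expr V n) → Prop
  | [] => True
  | E :: Es => Expr.NewArity fields E ∧ Expr.NewArityList fields Es
end

/-- In every `new C(E, ..., E)` of the process there are as many arguments as fields of `C`. -/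
def Proc.NewArity {V : Type} (fields : ClassName → List FieldName) :
    {n : ℕ} → Proc V n → Prop
  | _, .nil => True
  | _, .upd _ E P => E.NewArity fields ∧ P.NewArity fields
  | _, .letIn E P => E.NewArity fields ∧ P.NewArity fields
  | _, .send _ _ Es P => Expr.NewArityList fields Es ∧ P.NewArity fields
  | _, .cond E E' P Q =>
      E.NewArity fields ∧ E'.NewArity fields ∧ P.NewArity fields ∧ Q.NewArity fields
  | _, .plus P Q => P.NewArity fields ∧ Q.NewArity fields

/-- The expression is not of the form `new C(E, ..., E)` (and so contains no `new` at all). -/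
def Expr.NoNew {V : Type} {n : ℕ} : Expr V n → Prop
  | .field _ => True
  | .name _ => True
  | .new _ _ => False

/-- No `new` occurs in the process. -/
def Proc.NoNew {V : Type} : {n : ℕ} → Proc V n → Prop
  | _, .nil => True
  | _, .upd _ E P => E.NoNew ∧ P.NoNew
  | _, .letIn E P => E.NoNew ∧ P.NoNew
  | _, .send _ _ Es P => (∀ E ∈ Es, E.NoNew) ∧ P.NoNew
  | _, .cond E E' P Q => E.NoNew ∧ E'.NoNew ∧ P.NoNew ∧ Q.NoNew
  | _, .plus P Q => P.NoNew ∧ Q.NoNew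

/-- No field update occurs in the process. -/
def Proc.NoUpd {V : Type} : {n : ℕ} → Proc V n → Prop
  | _, .nil => True
  | _, .upd _ _ _ => False
  | _, .letIn _ P => P.NoUpd
  | _, .send _ _ _ P => P.NoUpd
  | _, .cond _ _ P Q => P.NoUpd ∧ Q.NoUpd
  | _, .plus P Q => P.NoUpd ∧ Q.NoUpd

/-! ### Programs -/

/-- A method definition `C.m(x₁, ..., xₖ) = P`. -/
structure MethodDef : Type where
  cls : ClassName
  name : MethodName
  params : List Var
  body : Proc Var 0

/-- A program: a main process, a finite set of method definitions, and the tuples of field names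
of the actor classes. -/
structure Program : Type where
  main : Proc Var 0
  defs : Finset MethodDef
  fields : ClassName → List FieldName

/-- Every pair of a class and a method name has at most one definition. -/
def Program.Unambiguous (p : Program) : Prop :=
  ∀ d ∈ p.defs, ∀ d' ∈ p.defs, d.cls = d'.cls → d.name = d'.name → d = d'

/-- Every `new C(E, ..., E)` of the program has as many arguments as `C` has fields, and the
methods of a class mention fields of that class only. -/
def Program.Correct (p : Program) : Prop :=
  (p.main.NewArity p.fields ∧ ∀ d ∈ p.defs, d.body.NewArity p.fields) ∧
    ∀ d ∈ p.defs, ∀ f ∈ d.body.fieldNames, f ∈ p.fields d.cls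

/-- Read-only fields: the program contains no field update. -/
def Program.ReadOnly (p : Program) : Prop :=
  p.main.NoUpd ∧ ∀ d ∈ p.defs, d.body.NoUpd

/-- Bounded actors: `new` occurs in the main process only. -/
def Program.BoundedActors (p : Program) : Prop :=
  ∀ d ∈ p.defs, d.body.NoNew

/-! ### Configurations -/

/-- A message `m(U₁, ..., Uₖ)`. -/
structure Message : Type where
  name : MethodName
  args : List Value

/-- The state of an actor: a map from the fields of its class to values. -/
abbrev FieldState := FieldName → Option Value

/-- The state that maps the fields `fs` to the values `Us`. -/
def FieldState.init (fs : List FieldName) (Us : List Value) : FieldState :=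
  fun f => (fs.zip Us).lookup f

/-- The part `(P, φ, q)` of a term `A ▹ (P, φ, q)`. -/
structure ActorState : Type where
  proc : Proc Value 0
  state : FieldState
  queue : List Message

/-- Configurations: sets of terms `A ▹ (P, φ, q)` with at most one term for every `A`. -/
abbrev Config := ActorName → Option ActorState

/-- The configuration `S` with the term of `A` (if any) replaced by `A ▹ a`. -/
def Config.set (S : Config) (A : ActorName) (a : ActorState) : Config :=
  Function.update S A (some a)

/-- `named C i` is the first unused actor name of the class `C`. -/
def Config.IsFresh (S : Config) (C : ClassName) (i : ℕ) : Prop :=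
  S (.named C i) = none ∧ ∀ j < i, S (.named C j) ≠ none

/-- The initial configuration `ℵ ▹ (main process, ∅, ε)`. -/
def Program.init (p : Program) : Config :=
  Config.set (fun _ => none) .root ⟨p.main.rename Value.var, fun _ => none, []⟩

/-- The variable `x` occurs in the configuration. -/
def Config.Uses (S : Config) (x : Var) : Prop :=
  ∃ A a, S A = some a ∧
    (Value.var x ∈ a.proc.fv ∨ (∃ f, a.state f = some (.var x)) ∨
      ∃ M ∈ a.queue, Value.var x ∈ M.args)

/-- The variable `x` occurs (free or as a formal parameter) in the program, or is `this`. -/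
def Program.Uses (p : Program) (x : Var) : Prop :=
  x = this ∨ x ∈ p.main.fv ∨ ∃ d ∈ p.defs, x ∈ d.params ∨ x ∈ d.body.fv

/-- The `k`-th variable (from `k = 0` on) that is used neither by the configuration nor by the
program. -/
noncomputable def Program.freshVar (p : Program) (S : Config) (k : ℕ) : Var :=
  Nat.nth (fun x => ¬ S.Uses x ∧ ¬ p.Uses x) k

/-! ### Operational semantics -/

mutual
/-- Evaluation of expressions in the state `φ`: `Eval fields φ S E U T` says that in the
configuration `S` the expression `E` has the value `U`, and that `T` consists of `S` and of the
actors created by the evaluation. Passing the whole configuration on makes the names of all actors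
created by one expression different. -/
inductive Eval (fields : ClassName → List FieldName) (φ : FieldState) :
    Config → Expr Value 0 → Value → Config → Prop
  | value (S : Config) (U : Value) : Eval fields φ S (.name (.free U)) U S
  | field (S : Config) (f : FieldName) (U : Value) (h : φ f = some U) :
      Eval fields φ S (.field f) U S
  | new (S T : Config) (C : ClassName) (Es : List (Expr Value 0)) (Us : List Value) (i : ℕ)
      (hE : EvalList fields φ S Es Us T) (hi : T.IsFresh C i) :
      Eval fields φ S (.new C Es) (.act (.named C i))
        (T.set (.named C i) ⟨.nil, FieldState.init (fields C) Us, []⟩)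
/-- Evaluation of tuples of expressions, from left to right. -/
inductive EvalList (fields : ClassName → List FieldName) (φ : FieldState) :
    Config → List (Expr Value 0) → List Value → Config → Prop
  | nil (S : Config) : EvalList fields φ S [] [] S
  | cons (S T R : Config) (E : Expr Value 0) (Es : List (Expr Value 0)) (U : Value)
      (Us : List Value) (hE : Eval fields φ S E U T) (hEs : EvalList fields φ T Es Us R) :
      EvalList fields φ S (E :: Es) (U :: Us) R
end

/-- The variables of a method body other than `this` and the formal parameters. -/
def MethodDef.localVars (d : MethodDef) : Finset Var :=
  (d.body.fv \ d.params.toFinset).erase this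

/-- The substitution that instantiates a method body: `this` becomes the actor `A`, the formal
parameters become the actual ones, and the remaining free variables `y₁ < y₂ < ...` become the
least unused variables, in this order. -/
noncomputable def Program.instSubst (p : Program) (S : Config) (d : MethodDef) (A : ActorName)
    (Us : List Value) (x : Var) : Value :=
  if x = this then .act A
  else ((d.params.zip Us).lookup x).getD
    (.var (p.freshVar S (Nat.count (fun y => y ∈ d.localVars) x)))

/-- The transition relation. Every rule is stated for a whole configuration, so that the closure
under contexts is built in. -/
inductive Program.Step (p : Program) : Config → Config → Prop
  | upd (S T : Config) (A : ActorName) (f : FieldName) (E : Expr Value 0) (P : Proc Value 0)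
      (φ : FieldState) (q : List Message) (U : Value)
      (hA : S A = some ⟨.upd f E P, φ, q⟩) (hE : Eval p.fields φ S E U T) :
      p.Step S (T.set A ⟨P, Function.update φ f (some U), q⟩)
  | letIn (S T : Config) (A : ActorName) (E : Expr Value 0) (P : Proc Value 1)
      (φ : FieldState) (q : List Message) (U : Value)
      (hA : S A = some ⟨.letIn E P, φ, q⟩) (hE : Eval p.fields φ S E U T) :
      p.Step S (T.set A ⟨P.open1 U, φ, q⟩)
  | invkSelf (S T : Config) (A : ActorName) (m : MethodName) (Es : List (Expr Value 0))
      (P : Proc Value 0) (φ : FieldState) (q : List Message) (Us : List Value)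
      (hA : S A = some ⟨.send (.free (.act A)) m Es P, φ, q⟩)
      (hE : EvalList p.fields φ S Es Us T) :
      p.Step S (T.set A ⟨P, φ, q ++ [⟨m, Us⟩]⟩)
  | invk (S T : Config) (A B : ActorName) (m : MethodName) (Es : List (Expr Value 0))
      (P P' : Proc Value 0) (φ φ' : FieldState) (q q' : List Message) (Us : List Value)
      (hAB : A ≠ B) (hA : S A = some ⟨.send (.free (.act B)) m Es P, φ, q⟩)
      (hB : S B = some ⟨P', φ', q'⟩) (hE : EvalList p.fields φ S Es Us T) :
      p.Step S ((T.set A ⟨P, φ, q⟩).set B ⟨P', φ', q' ++ [⟨m, Us⟩]⟩)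
  | inst (S : Config) (C : ClassName) (i : ℕ) (d : MethodDef) (φ : FieldState)
      (q : List Message) (Us : List Value)
      (hA : S (.named C i) = some ⟨.nil, φ, ⟨d.name, Us⟩ :: q⟩)
      (hd : d ∈ p.defs) (hC : d.cls = C) (hU : Us.length = d.params.length) :
      p.Step S (S.set (.named C i)
        ⟨d.body.rename (p.instSubst S d (.named C i) Us), φ, q⟩)
  | matched (S T : Config) (A : ActorName) (E E' : Expr Value 0) (P Q : Proc Value 0)
      (φ : FieldState) (q : List Message) (U : Value)
      (hA : S A = some ⟨.cond E E' P Q, φ, q⟩) (hE : EvalList p.fields φ S [E, E'] [U, U] T) :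
      p.Step S (T.set A ⟨P, φ, q⟩)
  | mismatched (S T : Config) (A : ActorName) (E E' : Expr Value 0) (P Q : Proc Value 0)
      (φ : FieldState) (q : List Message) (U V : Value)
      (hA : S A = some ⟨.cond E E' P Q, φ, q⟩) (hE : EvalList p.fields φ S [E, E'] [U, V] T)
      (hUV : U ≠ V) :
      p.Step S (T.set A ⟨Q, φ, q⟩)
  | plusL (S : Config) (A : ActorName) (P Q : Proc Value 0) (φ : FieldState)
      (q : List Message) (hA : S A = some ⟨.plus P Q, φ, q⟩) :
      p.Step S (S.set A ⟨P, φ, q⟩)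
  | plusR (S : Config) (A : ActorName) (P Q : Proc Value 0) (φ : FieldState)
      (q : List Message) (hA : S A = some ⟨.plus P Q, φ, q⟩) :
      p.Step S (S.set A ⟨Q, φ, q⟩)

/-- The configuration is reached by a computation of the program. -/
def Program.Reachable (p : Program) (S : Config) : Prop :=
  Relation.ReflTransGen p.Step p.init S

/-- The states of the transition system of the program. -/
def Program.State (p : Program) : Type :=
  {S : Config // p.Reachable S}

/-- The transitions of the transition system of the program. -/
def Program.Trans (p : Program) (s t : p.State) : Prop :=
  p.Step s.1 t.1

/-- No run-time type error: in no reachable configuration an actor of a class `C` is about to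
invoke a method of something that is not an actor name, or has in its queue a message for which
`C` has no method with that name and number of parameters. -/
def Program.TypeSafe (p : Program) : Prop :=
  ∀ S, p.Reachable S → ∀ (C : ClassName) (i : ℕ) (a : ActorState), S (.named C i) = some a →
    (∀ U m Es P, a.proc = .send (.free U) m Es P → ∃ B, U = .act B) ∧
    (∀ M ∈ a.queue, ∃ d ∈ p.defs, d.cls = C ∧ d.name = M.name ∧
      d.params.length = M.args.length)

/-! ### The ordering -/

/-- Renamings: functions that map the variables not free in the main process to values. -/
abbrev Program.Renaming (p : Program) := {x : Var // x ∉ p.main.fv} → Value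

/-- The value is an actor name or a free variable of the main process. -/
def Program.Rigid (p : Program) : Value → Prop
  | .var x => x ∈ p.main.fv
  | .act _ => True

/-- Renamings that generate the same partition and agree as soon as one of them returns an actor
name or a free variable of the main process. -/
def Program.RenEquiv (p : Program) (ρ ρ' : p.Renaming) : Prop :=
  (∀ x y, ρ x = ρ y ↔ ρ' x = ρ' y) ∧
    ∀ x, p.Rigid (ρ x) ∨ p.Rigid (ρ' x) → ρ x = ρ' x

/-- The action of a renaming on values: free variables of the main process and actor names are
kept. -/
def Program.applyRen (p : Program) (ρ : p.Renaming) : Value → Value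
  | .var x => if h : x ∈ p.main.fv then .var x else ρ ⟨x, h⟩
  | .act A => .act A

/-- The relation `≃` on processes. -/
inductive Program.ProcEquiv (p : Program) : Proc Value 0 → Proc Value 0 → Prop
  | mk (P : Proc Value 0) (ρ ρ' : p.Renaming) (h : p.RenEquiv ρ ρ') :
      p.ProcEquiv (P.rename (p.applyRen ρ)) (P.rename (p.applyRen ρ'))

/-- The relation `≃` on messages. -/
inductive Program.MsgEquiv (p : Program) : Message → Message → Prop
  | mk (m : MethodName) (xs : List {x : Var // x ∉ p.main.fv}) (ρ ρ' : p.Renaming)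
      (h : p.RenEquiv ρ ρ') :
      p.MsgEquiv ⟨m, xs.map ρ⟩ ⟨m, xs.map ρ'⟩

/-- The embedding of queues: the first is related message by message to a subword of the second. -/
def Program.QueueLE (p : Program) (q q' : List Message) : Prop :=
  List.SublistForall₂ p.MsgEquiv q q'

/-- The ordering of configurations: the same actors with the same states, equivalent processes
and embedded queues. -/
def Program.ConfigLE (p : Program) (S S' : Config) : Prop :=
  ∀ A, Option.Rel
    (fun a a' => p.ProcEquiv a.proc a'.proc ∧ a.state = a'.state ∧ p.QueueLE a.queue a'.queue)
    (S A) (S' A)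

/-- The ordering on the states of the transition system. -/
def Program.LE (p : Program) (s t : p.State) : Prop :=
  p.ConfigLE s.1 t.1

/-! ### Well-structured transition systems -/

/-- Well-structured transition systems. -/
structure IsWSTS {α : Type*} (trans le : α → α → Prop) : Prop where
  finitely_branching : ∀ s, {t | trans s t}.Finite
  le_refl : ∀ s, le s s
  le_trans : ∀ s t u, le s t → le t u → le s u
  well_quasi_ordered : ∀ s : ℕ → α, ∃ i j, i < j ∧ le (s i) (s j)
  upward_compatible : ∀ s₁ s₁' s₂, le s₁ s₁' → trans s₁ s₂ →
    ∃ s₂', Relation.ReflTransGen trans s₁' s₂' ∧ le s₂ s₂'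

end ActorLang

namespace ActorLang

/-! ### Substitution -/

-- The proof rests on three observations.
--
-- Symmetry. The relation `≃` is the orbit relation of the group of permutations of the values that
-- fix the rigid ones, i.e. the actor names and the free variables of the main process
-- (`Program.procEquiv_iff`, `Program.msgEquiv_iff`, both from `Program.exists_isAut`). A finite
-- family of values is determined up to this group by its partition and its rigid members. Hence
-- families of bounded length whose rigid members come from a finite set fall into finitely many
-- orbits.
--
-- Finiteness of everything but the queues. Only the root creates actors; its name is known to
-- nobody, so it receives no message, and its process shrinks with every step it makes. The root
-- process together with all actor states therefore takes finitely many values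
-- (`Program.finite_skeletons`), which bounds the set of actors and the rigid values in use. Every
-- other actor runs an instance of one of finitely many residuals of method bodies, and by type
-- safety messages have finitely many names and lengths. Higman's lemma for the queues and finite
-- products for the actors give the well-quasi-ordering (`Program.wellQuasiOrdered`).
--
-- Simulation. Created actors store rigid values only, because all names in the root process are
-- rigid; permutations thus fix the states, and method code commutes with them, while the root
-- process is the same in both configurations (`Program.exists_localStep_of_configLE`). When a
-- message is taken from a queue, the larger queue may contain other messages in front of it. These
-- can be consumed: type safety supplies a method for each, and method bodies run to completion
-- because processes shrink (`Program.exists_consumption`). Meanwhile the queues of the other actors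
-- only grow. The two instances of the body are then equivalent because their fresh variables
-- correspond position by position (`Program.procEquiv_inst`).

theorem Name.lift_rename {V W : Type} {n : ℕ} (σ : V → W) :
    Name.lift (Name.rename σ : Name V n → Name W n) = Name.rename σ := by
  funext x
  cases x with
  | bound i => cases i using Fin.cases <;> rfl
  | free v => rfl

theorem Name.lift_comp_lift {U V W : Type} {n k l : ℕ} (s : Name U n → Name V k)
    (t : Name V k → Name W l) : Name.lift t ∘ Name.lift s = Name.lift (t ∘ s) := by
  have key (y : Name V k) : Name.lift t y.shift = (t y).shift := by cases y <;> rfl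
  funext x
  cases x with
  | bound i =>
    cases i using Fin.cases with
    | zero => rfl
    | succ j => exact key _
  | free v => exact key _

theorem Name.rename_comp_rename {U V W : Type} {n : ℕ} (σ : U → V) (τ : V → W) :
    (Name.rename τ ∘ Name.rename σ : Name U n → Name W n) = Name.rename (τ ∘ σ) := by
  funext x
  cases x <;> rfl

mutual
theorem Expr.subst_subst {U V W : Type} {n k l : ℕ} (s : Name U n → Name V k)
    (t : Name V k → Name W l) :
    ∀ E : Expr U n, (E.subst s).subst t = E.subst (t ∘ s)
  | .field _ => rfl
  | .name _ => rfl
  | .new C Es => by simp only [Expr.subst, Expr.substList_substList s t Es]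
theorem Expr.substList_substList {U V W : Type} {n k l : ℕ} (s : Name U n → Name V k)
    (t : Name V k → Name W l) :
    ∀ Es : List (Expr U n), Expr.substList t (Expr.substList s Es) = Expr.substList (t ∘ s) Es
  | [] => rfl
  | E :: Es => by
    simp only [Expr.substList, Expr.subst_subst s t E, Expr.substList_substList s t Es]
end

theorem Proc.subst_subst {U V W : Type} {n : ℕ} (P : Proc U n) {k l : ℕ}
    (s : Name U n → Name V k) (t : Name V k → Name W l) :
    (P.subst s).subst t = P.subst (t ∘ s) := by
  induction P generalizing k l with
  | nil => rfl
  | upd f E P ih => simp only [Proc.subst, Expr.subst_subst, ih]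
  | letIn E P ih => simp only [Proc.subst, Expr.subst_subst, ih, Name.lift_comp_lift]
  | send x m Es P ih =>
    simp only [Proc.subst, Expr.substList_substList, ih, Function.comp_apply]
  | cond E E' P Q ih ih' => simp only [Proc.subst, Expr.subst_subst, ih, ih']
  | plus P Q ih ih' => simp only [Proc.subst, ih, ih']

/-- The expression in which every free name `v` is replaced by `σ v`. -/
def Expr.rename {V W : Type} {n : ℕ} (σ : V → W) (E : Expr V n) : Expr W n :=
  E.subst (Name.rename σ)

/-- The tuple of expressions in which every free name `v` is replaced by `σ v`. -/
def Expr.renameList {V W : Type} {n : ℕ} (σ : V → W) (Es : List (Expr V n)) : List (Expr W n) :=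
  Expr.substList (Name.rename σ) Es

section
variable {V W : Type} {n : ℕ} (σ : V → W)

@[simp] theorem Expr.renameList_cons (E : Expr V n) (Es : List (Expr V n)) :
    Expr.renameList σ (E :: Es) = E.rename σ :: Expr.renameList σ Es := rfl

@[simp] theorem Proc.rename_upd (f : FieldName) (E : Expr V n) (P : Proc V n) :
    (Proc.upd f E P).rename σ = .upd f (E.rename σ) (P.rename σ) := rfl

@[simp] theorem Proc.rename_letIn (E : Expr V n) (P : Proc V (n + 1)) :
    (Proc.letIn E P).rename σ = .letIn (E.rename σ) (P.rename σ) := by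
  simp only [Proc.rename, Proc.subst, Name.lift_rename, Expr.rename]

@[simp] theorem Proc.rename_send (x : Name V n) (m : MethodName) (Es : List (Expr V n))
    (P : Proc V n) :
    (Proc.send x m Es P).rename σ =
      .send (x.rename σ) m (Expr.renameList σ Es) (P.rename σ) := rfl

@[simp] theorem Proc.rename_cond (E E' : Expr V n) (P Q : Proc V n) :
    (Proc.cond E E' P Q).rename σ =
      .cond (E.rename σ) (E'.rename σ) (P.rename σ) (Q.rename σ) := rfl

@[simp] theorem Proc.rename_plus (P Q : Proc V n) :
    (Proc.plus P Q).rename σ = .plus (P.rename σ) (Q.rename σ) := rfl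

end

theorem Proc.rename_rename {U V W : Type} {n : ℕ} (σ : U → V) (τ : V → W) (P : Proc U n) :
    (P.rename σ).rename τ = P.rename (τ ∘ σ) := by
  rw [Proc.rename, Proc.rename, Proc.subst_subst, Name.rename_comp_rename, Proc.rename]

theorem Proc.rename_open1 {V W : Type} (σ : V → W) (U : V) (P : Proc V 1) :
    (P.open1 U).rename σ = (P.rename σ).open1 (σ U) := by
  rw [Proc.open1, Proc.open1, Proc.rename, Proc.rename, Proc.subst_subst, Proc.subst_subst]
  congr 1
  funext x
  cases x <;> rfl

/-! ### Free names -/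

theorem Name.rename_congr {V W : Type} {n : ℕ} {σ τ : V → W} (x : Name V n) (h : ∀ v ∈ x.fv, σ v = τ v) :
    x.rename σ = x.rename τ := by
  cases x with
  | bound i => rfl
  | free v => exact congrArg _ (h v (Finset.mem_singleton_self v))

section
variable {V W : Type} [DecidableEq V] {n : ℕ}

mutual
theorem Expr.rename_congr {σ τ : V → W} :
    ∀ E : Expr V n, (∀ v ∈ E.fv, σ v = τ v) → E.rename σ = E.rename τ
  | .field _, _ => rfl
  | .name x, h => congrArg Expr.name (Name.rename_congr x h)
  | .new C Es, h => congrArg (Expr.new C) (Expr.renameList_congr Es h)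
theorem Expr.renameList_congr {σ τ : V → W} :
    ∀ Es : List (Expr V n), (∀ v ∈ Expr.fvList Es, σ v = τ v) →
      Expr.renameList σ Es = Expr.renameList τ Es
  | [], _ => rfl
  | E :: Es, h => by
    rw [Expr.renameList_cons, Expr.renameList_cons,
      Expr.rename_congr E fun v hv => h v (Finset.mem_union_left _ hv),
      Expr.renameList_congr Es fun v hv => h v (Finset.mem_union_right _ hv)]
end

theorem Proc.rename_congr {σ τ : V → W} (P : Proc V n) (h : ∀ v ∈ P.fv, σ v = τ v) :
    P.rename σ = P.rename τ := by
  induction P with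
  | nil => rfl
  | upd f E P ih =>
    simp only [Proc.fv, Finset.mem_union] at h
    rw [Proc.rename_upd, Proc.rename_upd, ih fun v hv => h v (.inr hv),
      E.rename_congr fun v hv => h v (.inl hv)]
  | letIn E P ih =>
    simp only [Proc.fv, Finset.mem_union] at h
    rw [Proc.rename_letIn, Proc.rename_letIn, ih fun v hv => h v (.inr hv),
      E.rename_congr fun v hv => h v (.inl hv)]
  | send x m Es P ih =>
    simp only [Proc.fv, Finset.mem_union] at h
    rw [Proc.rename_send, Proc.rename_send, ih fun v hv => h v (.inr hv),
      Expr.renameList_congr Es fun v hv => h v (.inl (.inr hv)),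
      x.rename_congr fun v hv => h v (.inl (.inl hv))]
  | cond E E' P Q ih ih' =>
    simp only [Proc.fv, Finset.mem_union] at h
    rw [Proc.rename_cond, Proc.rename_cond, ih fun v hv => h v (.inl (.inr hv)),
      ih' fun v hv => h v (.inr hv), E.rename_congr fun v hv => h v (.inl (.inl (.inl hv))),
      E'.rename_congr fun v hv => h v (.inl (.inl (.inr hv)))]
  | plus P Q ih ih' =>
    simp only [Proc.fv, Finset.mem_union] at h
    rw [Proc.rename_plus, Proc.rename_plus, ih fun v hv => h v (.inl hv),
      ih' fun v hv => h v (.inr hv)]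

end

theorem Name.rename_id {V : Type} {n : ℕ} : (Name.rename id : Name V n → Name V n) = id := by
  funext x
  cases x <;> rfl

mutual
theorem Expr.subst_id {V : Type} {n : ℕ} : ∀ E : Expr V n, E.subst id = E
  | .field _ => rfl
  | .name _ => rfl
  | .new C Es => congrArg (Expr.new C) (Expr.substList_id Es)
theorem Expr.substList_id {V : Type} {n : ℕ} : ∀ Es : List (Expr V n), Expr.substList id Es = Es
  | [] => rfl
  | E :: Es => by rw [Expr.substList, Expr.subst_id E, Expr.substList_id Es]
end

@[simp] theorem Expr.rename_id {V : Type} {n : ℕ} (E : Expr V n) : E.rename id = E := by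
  rw [Expr.rename, Name.rename_id, Expr.subst_id]

@[simp] theorem Expr.renameList_id {V : Type} {n : ℕ} (Es : List (Expr V n)) :
    Expr.renameList id Es = Es := by
  rw [Expr.renameList, Name.rename_id, Expr.substList_id]

@[simp] theorem Proc.rename_id {V : Type} {n : ℕ} (P : Proc V n) : P.rename id = P := by
  have hn (n : ℕ) : (Name.rename id : Name V n → Name V n) = id := Name.rename_id
  induction P with
  | nil => rfl
  | send x m Es P ih => simp [ih, congrFun (hn _) x]
  | _ => simp_all

theorem Name.fv_rename {V W : Type} [DecidableEq W] {n : ℕ} (σ : V → W) (x : Name V n) :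
    (x.rename σ).fv = x.fv.image σ := by
  cases x <;> rfl

section
variable {V W : Type} [DecidableEq V] [DecidableEq W] {n : ℕ} (σ : V → W)

mutual
theorem Expr.fv_rename {n : ℕ} : ∀ E : Expr V n, (E.rename σ).fv = E.fv.image σ
  | .field _ => rfl
  | .name x => Name.fv_rename σ x
  | .new _ Es => Expr.fvList_renameList Es
theorem Expr.fvList_renameList {n : ℕ} :
    ∀ Es : List (Expr V n), Expr.fvList (Expr.renameList σ Es) = (Expr.fvList Es).image σ
  | [] => rfl
  | E :: Es => by
    rw [Expr.renameList_cons, Expr.fvList, Expr.fvList, Finset.image_union, Expr.fv_rename E,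
      Expr.fvList_renameList Es]
end

theorem Proc.fv_rename (P : Proc V n) : (P.rename σ).fv = P.fv.image σ := by
  induction P with
  | nil => rfl
  | _ => simp only [Proc.rename_upd, Proc.rename_letIn, Proc.rename_send, Proc.rename_cond,
      Proc.rename_plus, Proc.fv, Finset.image_union, Expr.fv_rename, Expr.fvList_renameList,
      Name.fv_rename, *]

end

theorem Name.fv_shift {V : Type} {n : ℕ} (x : Name V n) : x.shift.fv = x.fv := by
  cases x <;> rfl

section
variable {V W : Type} [DecidableEq V] [DecidableEq W]

mutual
theorem Expr.fv_subst_subset {n k : ℕ} {s : Name V n → Name W k} {D : Set W}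
    (hb : ∀ i, ∀ w ∈ (s (.bound i)).fv, w ∈ D) :
    ∀ E : Expr V n, (∀ v ∈ E.fv, ∀ w ∈ (s (.free v)).fv, w ∈ D) → ∀ w ∈ (E.subst s).fv, w ∈ D
  | .field _, _, _, h => absurd h (Finset.notMem_empty _)
  | .name (.bound i), _, w, hw => hb i w hw
  | .name (.free v), hf, w, hw => hf v (Finset.mem_singleton_self v) w hw
  | .new _ Es, hf, w, hw => Expr.fvList_substList_subset hb Es hf w hw
theorem Expr.fvList_substList_subset {n k : ℕ} {s : Name V n → Name W k} {D : Set W}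
    (hb : ∀ i, ∀ w ∈ (s (.bound i)).fv, w ∈ D) :
    ∀ Es : List (Expr V n), (∀ v ∈ Expr.fvList Es, ∀ w ∈ (s (.free v)).fv, w ∈ D) →
      ∀ w ∈ Expr.fvList (Expr.substList s Es), w ∈ D
  | [], _, _, h => absurd h (Finset.notMem_empty _)
  | E :: Es, hf, w, hw => by
    rcases Finset.mem_union.1 hw with hw | hw
    · exact Expr.fv_subst_subset hb E (fun v hv => hf v (Finset.mem_union_left _ hv)) w hw
    · exact Expr.fvList_substList_subset hb Es (fun v hv => hf v (Finset.mem_union_right _ hv)) w hw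
end

/-- Bound indices may become free names too, as in `Proc.open1`, hence the separate hypothesis on
them. Both hypotheses survive a binder: the new index contributes no free name, and shifting changes
none. -/
theorem Proc.fv_subst_subset {n : ℕ} (P : Proc V n) {k : ℕ} {s : Name V n → Name W k} {D : Set W}
    (hb : ∀ i, ∀ w ∈ (s (.bound i)).fv, w ∈ D)
    (hf : ∀ v ∈ P.fv, ∀ w ∈ (s (.free v)).fv, w ∈ D) : ∀ w ∈ (P.subst s).fv, w ∈ D := by
  induction P generalizing k with
  | nil => exact fun w hw => absurd hw (Finset.notMem_empty _)
  | upd f E P ih =>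
    simp only [Proc.fv, Proc.subst, Finset.mem_union] at hf ⊢
    rintro w (hw | hw)
    · exact Expr.fv_subst_subset hb E (fun v hv => hf v (.inl hv)) w hw
    · exact ih hb (fun v hv => hf v (.inr hv)) w hw
  | letIn E P ih =>
    simp only [Proc.fv, Proc.subst, Finset.mem_union] at hf ⊢
    rintro w (hw | hw)
    · exact Expr.fv_subst_subset hb E (fun v hv => hf v (.inl hv)) w hw
    · refine ih (s := Name.lift s) (fun i => ?_) (fun v hv w hw => ?_) w hw
      · cases i using Fin.cases with
        | zero => exact fun w hw => absurd hw (Finset.notMem_empty _)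
        | succ j => exact fun w hw => hb j w (Name.fv_shift _ ▸ hw)
      · exact hf v (.inr hv) w (Name.fv_shift (s (.free v)) ▸ hw)
  | send x m Es P ih =>
    simp only [Proc.fv, Proc.subst, Finset.mem_union] at hf ⊢
    rintro w ((hw | hw) | hw)
    · exact Expr.fv_subst_subset hb (.name x) (fun v hv => hf v (.inl (.inl hv))) w hw
    · exact Expr.fvList_substList_subset hb Es (fun v hv => hf v (.inl (.inr hv))) w hw
    · exact ih hb (fun v hv => hf v (.inr hv)) w hw
  | cond E E' P Q ih ih' =>
    simp only [Proc.fv, Proc.subst, Finset.mem_union] at hf ⊢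
    rintro w (((hw | hw) | hw) | hw)
    · exact Expr.fv_subst_subset hb E (fun v hv => hf v (.inl (.inl (.inl hv)))) w hw
    · exact Expr.fv_subst_subset hb E' (fun v hv => hf v (.inl (.inl (.inr hv)))) w hw
    · exact ih hb (fun v hv => hf v (.inl (.inr hv))) w hw
    · exact ih' hb (fun v hv => hf v (.inr hv)) w hw
  | plus P Q ih ih' =>
    simp only [Proc.fv, Proc.subst, Finset.mem_union] at hf ⊢
    rintro w (hw | hw)
    · exact ih hb (fun v hv => hf v (.inl hv)) w hw
    · exact ih' hb (fun v hv => hf v (.inr hv)) w hw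

theorem Proc.fv_open1_subset (P : Proc V 1) (U : V) : (P.open1 U).fv ⊆ insert U P.fv := by
  intro w hw
  rw [Finset.mem_insert]
  refine P.fv_subst_subset (s := Name.open1 U) (D := {w | w = U ∨ w ∈ P.fv}) (fun _ w hw => ?_)
    (fun v hv w hw => ?_) w hw
  · exact .inl (Finset.mem_singleton.1 hw)
  · exact .inr (Finset.mem_singleton.1 hw ▸ hv)

end

/-- Whatever value a `let` receives can be absorbed into the renaming, once its variable has been
replaced by a fixed fresh name. This is what keeps the set of residuals finite. -/
theorem Proc.open1_rename_update {V W : Type} [DecidableEq V] (P : Proc V 1) (σ : V → W) {z : V} (hz : z ∉ P.fv) (U : W) :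
    (P.rename σ).open1 U = (P.open1 z).rename (Function.update σ z U) := by
  rw [Proc.rename_open1, Function.update_self]
  congr 1
  exact P.rename_congr fun v hv => (Function.update_of_ne (ne_of_mem_of_not_mem hv hz) _ _).symm

/-! ### Syntactic restrictions -/

section
variable {V W : Type}

theorem Expr.substList_eq_map {n k : ℕ} (s : Name V n → Name W k) (Es : List (Expr V n)) :
    Expr.substList s Es = Es.map (Expr.subst s) := by
  induction Es with
  | nil => rfl
  | cons E Es ih => rw [Expr.substList, ih, List.map_cons]

@[simp] theorem Expr.noNew_subst {n k : ℕ} (s : Name V n → Name W k) (E : Expr V n) :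
    (E.subst s).NoNew ↔ E.NoNew := by
  cases E <;> rfl

@[simp] theorem Proc.noNew_subst {n : ℕ} (P : Proc V n) {k : ℕ} (s : Name V n → Name W k) :
    (P.subst s).NoNew ↔ P.NoNew := by
  induction P generalizing k with
  | nil => rfl
  | _ => simp only [Proc.NoNew, Proc.subst, Expr.noNew_subst, Expr.substList_eq_map,
      List.forall_mem_map, *]

@[simp] theorem Proc.noUpd_subst {n : ℕ} (P : Proc V n) {k : ℕ} (s : Name V n → Name W k) :
    (P.subst s).NoUpd ↔ P.NoUpd := by
  induction P generalizing k with
  | nil => rfl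
  | _ => simp only [Proc.NoUpd, Proc.subst, *]

mutual
theorem Expr.newArity_subst (fields : ClassName → List FieldName) {n k : ℕ}
    (s : Name V n → Name W k) :
    ∀ E : Expr V n, (E.subst s).NewArity fields ↔ E.NewArity fields
  | .field _ => Iff.rfl
  | .name _ => Iff.rfl
  | .new _ Es => by
    rw [Expr.subst, Expr.NewArity, Expr.NewArity, Expr.newArityList_substList fields s Es,
      Expr.substList_eq_map, List.length_map]
theorem Expr.newArityList_substList (fields : ClassName → List FieldName) {n k : ℕ}
    (s : Name V n → Name W k) :
    ∀ Es : List (Expr V n),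
      Expr.NewArityList fields (Expr.substList s Es) ↔ Expr.NewArityList fields Es
  | [] => Iff.rfl
  | E :: Es => by
    rw [Expr.substList, Expr.NewArityList, Expr.NewArityList, Expr.newArity_subst fields s E,
      Expr.newArityList_substList fields s Es]
end

@[simp] theorem Proc.newArity_subst (fields : ClassName → List FieldName) {n : ℕ} (P : Proc V n)
    {k : ℕ} (s : Name V n → Name W k) : (P.subst s).NewArity fields ↔ P.NewArity fields := by
  induction P generalizing k with
  | nil => rfl
  | _ => simp only [Proc.NewArity, Proc.subst, Expr.newArity_subst, Expr.newArityList_substList, *]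

mutual
theorem Expr.fieldNames_subst {n k : ℕ} (s : Name V n → Name W k) :
    ∀ E : Expr V n, (E.subst s).fieldNames = E.fieldNames
  | .field _ => rfl
  | .name _ => rfl
  | .new _ Es => Expr.fieldNamesList_substList s Es
theorem Expr.fieldNamesList_substList {n k : ℕ} (s : Name V n → Name W k) :
    ∀ Es : List (Expr V n),
      Expr.fieldNamesList (Expr.substList s Es) = Expr.fieldNamesList Es
  | [] => rfl
  | E :: Es => by
    rw [Expr.substList, Expr.fieldNamesList, Expr.fieldNamesList, Expr.fieldNames_subst s E,
      Expr.fieldNamesList_substList s Es]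
end

@[simp] theorem Proc.fieldNames_subst {n : ℕ} (P : Proc V n) {k : ℕ} (s : Name V n → Name W k) :
    (P.subst s).fieldNames = P.fieldNames := by
  induction P generalizing k with
  | nil => rfl
  | _ => simp only [Proc.fieldNames, Proc.subst, Expr.fieldNames_subst,
      Expr.fieldNamesList_substList, *]

/-- The number of operators of a process. -/
def Proc.size : {n : ℕ} → Proc V n → ℕ
  | _, .nil => 0
  | _, .upd _ _ P => P.size + 1
  | _, .letIn _ P => P.size + 1
  | _, .send _ _ _ P => P.size + 1
  | _, .cond _ _ P Q => P.size + Q.size + 1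
  | _, .plus P Q => P.size + Q.size + 1

@[simp] theorem Proc.size_subst {n : ℕ} (P : Proc V n) {k : ℕ} (s : Name V n → Name W k) :
    (P.subst s).size = P.size := by
  induction P generalizing k with
  | nil => rfl
  | _ => simp only [Proc.size, Proc.subst, *]

@[simp] theorem Proc.size_open1 (P : Proc V 1) (U : V) : (P.open1 U).size = P.size :=
  P.size_subst _

end

/-! ### The equivalences on processes and messages -/

/-- Permutations of the values that fix the actor names and the free variables of the main
process. -/
def Program.IsAut (p : Program) (θ : Equiv.Perm Value) : Prop :=
  ∀ v, p.Rigid v → θ v = v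

theorem Program.IsAut.one (p : Program) : p.IsAut 1 := fun _ _ => rfl

theorem Program.IsAut.mul {p : Program} {θ η : Equiv.Perm Value} (hθ : p.IsAut θ)
    (hη : p.IsAut η) : p.IsAut (θ * η) := fun v hv => by
  rw [Equiv.Perm.mul_apply, hη v hv, hθ v hv]

theorem Program.IsAut.rigid_iff {p : Program} {θ : Equiv.Perm Value} (hθ : p.IsAut θ) (v : Value) :
    p.Rigid (θ v) ↔ p.Rigid v := by
  refine ⟨fun h => ?_, fun h => (hθ v h).symm ▸ h⟩
  have := θ.injective (hθ _ h)
  rwa [this] at h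

/-- Two finite families of values with the same partition and the same rigid members differ by a
permutation of the values. -/
theorem Program.exists_isAut (p : Program) {ι : Type*} [Finite ι] (f g : ι → Value)
    (hfg : ∀ i j, f i = f j ↔ g i = g j)
    (hr : ∀ i, p.Rigid (f i) ∨ p.Rigid (g i) → f i = g i) :
    ∃ θ, p.IsAut θ ∧ ∀ i, θ (f i) = g i := by
  classical
  -- `α` is the finite set of non-rigid values of `f`, and `s` picks an index for each. The
  -- inclusion `F` and its counterpart `G` are injections into the non-rigid values; a permutation
  -- carrying one to the other is extended by the identity on the rigid values.
  let α := Set.range fun j : {i // ¬ p.Rigid (f i)} => f j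
  have hα (a : α) : ∃ j : {i // ¬ p.Rigid (f i)}, f j = a := a.2
  choose s hs using hα
  let F (a : α) : {v // ¬ p.Rigid v} := ⟨f (s a), (s a).2⟩
  let G (a : α) : {v // ¬ p.Rigid v} :=
    ⟨g (s a), fun h => (s a).2 ((hr _ (.inr h)).symm ▸ h)⟩
  obtain ⟨θ, hθ⟩ := Equiv.Perm.exists_extending_pair F G
    (fun a b h => Subtype.ext (by simpa [F, hs] using h))
    (fun a b h => Subtype.ext (by
      have : g (s a) = g (s b) := congrArg Subtype.val h
      rw [← hfg] at this
      simpa [hs] using this))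
  refine ⟨Equiv.Perm.ofSubtype θ, fun v hv => ?_, fun i => ?_⟩
  · exact Equiv.Perm.ofSubtype_apply_of_not_mem θ (not_not.2 hv)
  · by_cases hi : p.Rigid (f i)
    · rw [Equiv.Perm.ofSubtype_apply_of_not_mem θ (not_not.2 hi), hr i (.inl hi)]
    · rw [Equiv.Perm.ofSubtype_apply_of_mem θ hi]
      let a : α := ⟨f i, ⟨i, hi⟩, rfl⟩
      have : F a = ⟨f i, hi⟩ := Subtype.ext (hs a)
      rw [← this, hθ a]
      exact (hfg _ _).1 (hs a)

/-- The extension of a renaming to all values is the identity on the values outside its domain, all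
of which are rigid. The only new comparisons are with such values, and there the two renamings
agree. -/
theorem Program.RenEquiv.applyRen {p : Program} {ρ ρ' : p.Renaming} (h : p.RenEquiv ρ ρ') :
    (∀ v w, p.applyRen ρ v = p.applyRen ρ w ↔ p.applyRen ρ' v = p.applyRen ρ' w) ∧
      ∀ v, p.Rigid (p.applyRen ρ v) ∨ p.Rigid (p.applyRen ρ' v) →
        p.applyRen ρ v = p.applyRen ρ' v := by
  have key (v : Value) : (∃ x, ∀ σ : p.Renaming, p.applyRen σ v = σ x) ∨
      (p.Rigid v ∧ ∀ σ, p.applyRen σ v = v) := by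
    rcases v with x | A
    · by_cases hx : x ∈ p.main.fv
      · exact .inr ⟨hx, fun σ => dif_pos hx⟩
      · exact .inl ⟨⟨x, hx⟩, fun σ => dif_neg hx⟩
    · exact .inr ⟨trivial, fun σ => rfl⟩
  have mixed (x) {w : Value} (hw : p.Rigid w) : ρ x = w ↔ ρ' x = w :=
    ⟨fun e => h.2 x (.inl (e ▸ hw)) ▸ e, fun e => (h.2 x (.inr (e ▸ hw))).symm ▸ e⟩
  refine ⟨fun v w => ?_, fun v hv => ?_⟩
  · rcases key v with ⟨x, hx⟩ | ⟨hv, hv'⟩ <;> rcases key w with ⟨y, hy⟩ | ⟨hw, hw'⟩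
    · rw [hx, hx, hy, hy, h.1]
    · rw [hx, hx, hw', hw', mixed x hw]
    · rw [hv', hv', hy, hy, eq_comm, mixed y hv, eq_comm]
    · rw [hv', hv', hw', hw']
  · rcases key v with ⟨x, hx⟩ | ⟨_, hv'⟩
    · rw [hx, hx] at *
      exact h.2 x hv
    · rw [hv', hv']

/-- Renamings need not be injective, but a process has finitely many free names, so the
correspondence between their images extends to a permutation. Conversely, a permutation `θ` comes
from the pair of renamings given by the identity and `θ`. In this form transitivity is just
composition. -/
theorem Program.procEquiv_iff (p : Program) (P P' : Proc Value 0) :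
    p.ProcEquiv P P' ↔ ∃ θ, p.IsAut θ ∧ P' = P.rename θ := by
  constructor
  · rintro ⟨P, ρ, ρ', h⟩
    obtain ⟨h₁, h₂⟩ := h.applyRen
    obtain ⟨θ, hθ, hθP⟩ := p.exists_isAut (fun v : P.fv => p.applyRen ρ v)
      (fun v : P.fv => p.applyRen ρ' v) (fun _ _ => h₁ _ _) (fun _ => h₂ _)
    refine ⟨θ, hθ, ?_⟩
    rw [Proc.rename_rename]
    exact P.rename_congr fun v hv => (hθP ⟨v, hv⟩).symm
  · rintro ⟨θ, hθ, rfl⟩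
    have happ (η : Equiv.Perm Value) (hη : p.IsAut η) :
        p.applyRen (fun x => η (.var x)) = η := by
      funext v
      rcases v with x | A
      · by_cases hx : x ∈ p.main.fv
        · exact (dif_pos hx).trans (hη (.var x) hx).symm
        · rw [Program.applyRen, dif_neg hx]
      · exact (hη (.act A) trivial).symm
    have := Program.ProcEquiv.mk (p := p) P (fun x => (1 : Equiv.Perm Value) (.var x))
      (fun x => θ (.var x))
      ⟨fun x y => by rw [EmbeddingLike.apply_eq_iff_eq, EmbeddingLike.apply_eq_iff_eq],
        fun x hx => (hθ _ (by simpa [hθ.rigid_iff] using hx)).symm⟩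
    rwa [happ _ (.one p), happ θ hθ, Equiv.Perm.coe_one, Proc.rename_id] at this

instance : Countable ActorName :=
  Function.Injective.countable (f := fun A : ActorName => match A with
    | .root => none
    | .named C i => some (C, i)) (by rintro (_ | _) (_ | _) h <;> simp_all)

instance : Countable Value :=
  Function.Injective.countable (f := fun v : Value => match v with
    | .var x => Sum.inl x
    | .act A => Sum.inr A) (by rintro (_ | _) (_ | _) h <;> simp_all)

theorem Program.msgEquiv_iff (p : Program) (M M' : Message) :
    p.MsgEquiv M M' ↔ ∃ θ, p.IsAut θ ∧ M' = ⟨M.name, M.args.map θ⟩ := by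
  constructor
  · rintro ⟨m, xs, ρ, ρ', h⟩
    obtain ⟨θ, hθ, hθx⟩ := p.exists_isAut (fun x : {x // x ∈ xs} => ρ x)
      (fun x : {x // x ∈ xs} => ρ' x) (fun _ _ => h.1 _ _) (fun _ => h.2 _)
    refine ⟨θ, hθ, ?_⟩
    rw [List.map_map]
    congr 1
    exact List.map_congr_left fun x hx => (hθx ⟨x, hx⟩).symm
  · rintro ⟨θ, hθ, rfl⟩
    -- The arguments have to be presented as images of variables not free in the main process, even
    -- those that are rigid. All values are therefore coded injectively by such variables, and `ρ`
    -- is the decoding.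
    have : Infinite {x : Var // x ∉ p.main.fv} := p.main.fv.finite_toSet.infinite_compl.to_subtype
    obtain ⟨e, he⟩ : ∃ e : Value → {x : Var // x ∉ p.main.fv}, Function.Injective e := by
      obtain ⟨e, he⟩ := exists_injective_nat Value
      exact ⟨_, (Infinite.natEmbedding {x : Var // x ∉ p.main.fv}).injective.comp he⟩
    have : Nonempty Value := ⟨.var 0⟩
    let ρ : p.Renaming := Function.invFun e
    have hρ : (ρ ∘ e) = id := Function.invFun_comp he
    have := Program.MsgEquiv.mk (p := p) M.name (M.args.map e) ρ (fun x => θ (ρ x))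
      ⟨fun x y => by rw [EmbeddingLike.apply_eq_iff_eq],
        fun x hx => (hθ _ (by simpa [hθ.rigid_iff] using hx)).symm⟩
    have h₂ : ((fun x => θ (ρ x)) ∘ e) = θ := by
      funext v
      exact congrArg θ (congrFun hρ v)
    rwa [List.map_map, List.map_map, hρ, List.map_id, h₂] at this

theorem Program.ProcEquiv.refl (p : Program) (P : Proc Value 0) : p.ProcEquiv P P :=
  (p.procEquiv_iff P P).2 ⟨1, .one p, by rw [Equiv.Perm.coe_one, Proc.rename_id]⟩

theorem Program.ProcEquiv.trans {p : Program} {P Q R : Proc Value 0} (h : p.ProcEquiv P Q)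
    (h' : p.ProcEquiv Q R) : p.ProcEquiv P R := by
  obtain ⟨θ, hθ, rfl⟩ := (p.procEquiv_iff _ _).1 h
  obtain ⟨η, hη, rfl⟩ := (p.procEquiv_iff _ _).1 h'
  exact (p.procEquiv_iff _ _).2 ⟨η * θ, hη.mul hθ, by rw [Proc.rename_rename, Equiv.Perm.coe_mul]⟩

instance (p : Program) : IsPreorder (Proc Value 0) p.ProcEquiv where
  refl := .refl p
  trans _ _ _ := .trans

instance (p : Program) : IsPreorder Message p.MsgEquiv where
  refl M := (p.msgEquiv_iff M M).2 ⟨1, .one p, by simp⟩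
  trans M N K h h' := by
    obtain ⟨θ, hθ, rfl⟩ := (p.msgEquiv_iff _ _).1 h
    obtain ⟨η, hη, rfl⟩ := (p.msgEquiv_iff _ _).1 h'
    exact (p.msgEquiv_iff _ _).2 ⟨η * θ, hη.mul hθ, by simp⟩

instance (p : Program) : IsPreorder (List Message) p.QueueLE where
  refl q := refl_of (List.SublistForall₂ p.MsgEquiv) q
  trans _ _ _ := trans_of (List.SublistForall₂ p.MsgEquiv)

/-! ### Families of values up to equivalence -/

open Classical in
/-- The partition generated by a family of values, and its rigid members. -/
noncomputable def Program.pattern (p : Program) {R : Finset Value} {ι : Type}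
    (f : {f : ι → Value // ∀ i, p.Rigid (f i) → f i ∈ R}) : (ι → ι → Prop) × (ι → Option R) :=
  (fun i j => f.1 i = f.1 j, fun i => if h : p.Rigid (f.1 i) then some ⟨f.1 i, f.2 i h⟩ else none)

theorem Program.exists_isAut_of_pattern_eq (p : Program) {R : Finset Value} {ι : Type} [Finite ι]
    {f g : {f : ι → Value // ∀ i, p.Rigid (f i) → f i ∈ R}} (h : p.pattern f = p.pattern g) :
    ∃ θ, p.IsAut θ ∧ ∀ i, θ (f.1 i) = g.1 i := by
  obtain ⟨h₁, h₂⟩ := Prod.ext_iff.1 h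
  refine p.exists_isAut f.1 g.1 (fun i j => iff_of_eq (congrFun₂ h₁ i j)) fun i hi => ?_
  have := congrFun h₂ i
  simp only [Program.pattern] at this
  by_cases hf : p.Rigid (f.1 i) <;> by_cases hg : p.Rigid (g.1 i) <;> simp_all

/-- A set whose elements are given by finite families of values with finitely many rigid members
is well-quasi-ordered by any relation that such permutations preserve. -/
theorem Program.partiallyWellOrderedOn_families (p : Program) (R : Finset Value) {ι α : Type}
    [Finite ι] {r : α → α → Prop} (F : (ι → Value) → α)
    (hr : ∀ f θ, p.IsAut θ → r (F f) (F (θ ∘ f))) :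
    {a | ∃ f, (∀ i, p.Rigid (f i) → f i ∈ R) ∧ F f = a}.PartiallyWellOrderedOn r := by
  rw [Set.partiallyWellOrderedOn_iff_exists_lt]
  intro a ha
  choose f hf hfa using ha
  -- Pigeonhole: patterns form a finite type because `ι` and `R` are finite.
  obtain ⟨m, n, hmn, h⟩ := Finite.exists_ne_map_eq_of_infinite fun n => p.pattern ⟨f n, hf n⟩
  wlog hlt : m < n generalizing m n
  · exact this n m hmn.symm h.symm (lt_of_le_of_ne (not_lt.1 hlt) hmn.symm)
  obtain ⟨θ, hθ, hθf⟩ := p.exists_isAut_of_pattern_eq h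
  refine ⟨m, n, hlt, ?_⟩
  rw [← hfa, ← hfa, show f n = θ ∘ f m from (funext hθf).symm]
  exact hr _ θ hθ

/-- The instances of a process. -/
theorem Program.partiallyWellOrderedOn_rename (p : Program) (R : Finset Value) (Q : Proc Value 0) :
    {P | ∃ σ : Value → Value, P = Q.rename σ ∧ ∀ v ∈ P.fv, p.Rigid v → v ∈ R}.PartiallyWellOrderedOn
      p.ProcEquiv := by
  classical
  let F (f : Q.fv → Value) : Proc Value 0 :=
    Q.rename fun v => if h : v ∈ Q.fv then f ⟨v, h⟩ else v
  refine (p.partiallyWellOrderedOn_families R F fun f θ hθ => ?_).mono ?_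
  · refine (p.procEquiv_iff _ _).2 ⟨θ, hθ, ?_⟩
    simp only [F, Proc.rename_rename]
    exact Q.rename_congr fun v hv => by simp [hv]
  · rintro P ⟨σ, rfl, hσ⟩
    refine ⟨fun v => σ v, fun i => hσ _ ?_, Q.rename_congr fun v hv => by simp [hv]⟩
    rw [Proc.fv_rename]
    exact Finset.mem_image_of_mem σ i.2

/-- Messages with a given name and a given number of arguments. -/
theorem Program.partiallyWellOrderedOn_messages (p : Program) (R : Finset Value) (m : MethodName)
    (k : ℕ) :
    {M : Message | M.name = m ∧ M.args.length = k ∧ ∀ v ∈ M.args, p.Rigid v → v ∈ R}.PartiallyWellOrderedOn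
      p.MsgEquiv := by
  refine (p.partiallyWellOrderedOn_families R (ι := Fin k)
    (fun f => ⟨m, List.ofFn f⟩) fun f θ hθ => ?_).mono ?_
  · exact (p.msgEquiv_iff _ _).2 ⟨θ, hθ, by simp⟩
  · rintro ⟨m, Us⟩ ⟨rfl, rfl, h⟩
    exact ⟨fun i => Us[i], fun i => h _ (List.getElem_mem _), by simp⟩

/-! ### Evaluation -/

section
variable {fields : ClassName → List FieldName} {φ : FieldState}

/-- The actors of a configuration. -/
def Config.dom (S : Config) : Set ActorName := {A | S A ≠ none}

theorem Config.mem_dom_of_eq_some {S : Config} {A : ActorName} {a : ActorState}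
    (h : S A = some a) : A ∈ S.dom := by
  rw [Config.dom, Set.mem_ofPred_eq, h]
  exact Option.some_ne_none a

theorem Config.mem_dom_iff {S : Config} {A : ActorName} : A ∈ S.dom ↔ ∃ a, S A = some a :=
  Option.ne_none_iff_exists'

theorem Config.dom_set (S : Config) (A : ActorName) (a : ActorState) :
    (S.set A a).dom = insert A S.dom := by
  ext B
  rcases eq_or_ne B A with rfl | h <;> simp [Config.dom, Config.set, *]

theorem Config.IsFresh.eq {S : Config} {C : ClassName} {i j : ℕ} (hi : S.IsFresh C i)
    (hj : S.IsFresh C j) : i = j := by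
  rcases lt_trichotomy i j with h | h | h
  · exact absurd hi.1 (hj.2 i h)
  · exact h
  · exact absurd hj.1 (hi.2 j h)

mutual
-- Determinism holds because the first unused name is unique; it is the source of finite branching.
theorem Eval.unique {S : Config} {E : Expr Value 0} {U U' : Value} {T T' : Config}
    (h : Eval fields φ S E U T) (h' : Eval fields φ S E U' T') : U = U' ∧ T = T' := by
  cases h with
  | value => cases h'; exact ⟨rfl, rfl⟩
  | field _ f U hf =>
    cases h' with
    | field _ f' U' hf' => exact ⟨Option.some.inj (hf.symm.trans hf'), rfl⟩
  | new _ T C Es Us i hE hi =>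
    cases h' with
    | new _ T' _ _ Us' i' hE' hi' =>
      obtain ⟨rfl, rfl⟩ := EvalList.unique hE hE'
      obtain rfl := hi.eq hi'
      exact ⟨rfl, rfl⟩
theorem EvalList.unique {S : Config} {Es : List (Expr Value 0)} {Us Us' : List Value}
    {T T' : Config} (h : EvalList fields φ S Es Us T) (h' : EvalList fields φ S Es Us' T') :
    Us = Us' ∧ T = T' := by
  cases h with
  | nil => cases h'; exact ⟨rfl, rfl⟩
  | cons _ T R₁ E Es U Us hE hEs =>
    cases h' with
    | cons _ T' R' _ _ U' Us' hE' hEs' =>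
      obtain ⟨rfl, rfl⟩ := Eval.unique hE hE'
      obtain ⟨rfl, rfl⟩ := EvalList.unique hEs hEs'
      exact ⟨rfl, rfl⟩
end

mutual
theorem Eval.mono {S : Config} {E : Expr Value 0} {U : Value} {T : Config}
    (h : Eval fields φ S E U T) {A : ActorName} {a : ActorState} (hA : S A = some a) :
    T A = some a := by
  cases h with
  | value => exact hA
  | field => exact hA
  | new _ T C Es Us i hE hi =>
    have := EvalList.mono hE hA
    rw [Config.set, Function.update_of_ne, this]
    rintro rfl
    rw [hi.1] at this
    cases this
theorem EvalList.mono {S : Config} {Es : List (Expr Value 0)} {Us : List Value}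
    {T : Config} (h : EvalList fields φ S Es Us T) {A : ActorName} {a : ActorState}
    (hA : S A = some a) : T A = some a := by
  cases h with
  | nil => exact hA
  | cons _ T R₁ E Es U Us hE hEs => exact EvalList.mono hEs (Eval.mono hE hA)
end

theorem Eval.eq_of_noNew {S : Config} {E : Expr Value 0} {U : Value} {T : Config}
    (h : Eval fields φ S E U T) (hE : E.NoNew) : T = S := by
  cases h with
  | value => rfl
  | field => rfl
  | new => exact hE.elim

theorem EvalList.eq_of_noNew {S : Config} {Es : List (Expr Value 0)} {Us : List Value}
    {T : Config} (h : EvalList fields φ S Es Us T) (hE : ∀ E ∈ Es, E.NoNew) : T = S := by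
  induction Es generalizing S Us with
  | nil => cases h; rfl
  | cons E Es ih =>
    cases h with
    | cons _ T _ _ _ U Us h h' =>
      obtain rfl := h.eq_of_noNew (hE E List.mem_cons_self)
      exact ih h' fun E' hE' => hE E' (List.mem_cons_of_mem _ hE')

/-- Evaluation without creation of actors commutes with permutations that fix the state. -/
theorem Eval.rename {S : Config} {E : Expr Value 0} {U : Value} {T : Config}
    (h : Eval fields φ S E U T) (hE : E.NoNew) {θ : Value → Value}
    (hθ : ∀ f V, φ f = some V → θ V = V) (S' : Config) :
    Eval fields φ S' (E.rename θ) (θ U) S' := by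
  cases h with
  | value => exact .value _ _
  | field _ f U hf => rw [hθ f U hf]; exact .field _ f U hf
  | new => exact hE.elim

theorem EvalList.rename {S : Config} {Es : List (Expr Value 0)} {Us : List Value}
    {T : Config} (h : EvalList fields φ S Es Us T) (hE : ∀ E ∈ Es, E.NoNew) {θ : Value → Value}
    (hθ : ∀ f V, φ f = some V → θ V = V) (S' : Config) :
    EvalList fields φ S' (Expr.renameList θ Es) (Us.map θ) S' := by
  induction Es generalizing S Us with
  | nil => cases h; exact .nil _
  | cons E Es ih =>
    cases h with
    | cons _ T _ _ _ U Us h h' =>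
      exact .cons _ _ _ _ _ _ _ (h.rename (hE E List.mem_cons_self) hθ S')
        (ih h' fun E' hE' => hE E' (List.mem_cons_of_mem _ hE'))

-- Configurations with the same actors

/-- Two configurations have the same actors, and corresponding terms are related. -/
def Config.Rel (R : ActorName → ActorState → ActorState → Prop) (S S' : Config) : Prop :=
  ∀ A, Option.Rel (R A) (S A) (S' A)

theorem Config.Rel.eq_none_iff {R : ActorName → ActorState → ActorState → Prop} {S S' : Config}
    (h : Config.Rel R S S') (A : ActorName) : S A = none ↔ S' A = none := by
  have := h A
  generalize S A = o at this ⊢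
  generalize S' A = o' at this ⊢
  cases this <;> simp

theorem Config.Rel.mem_dom_iff {R : ActorName → ActorState → ActorState → Prop} {S S' : Config}
    (h : Config.Rel R S S') (A : ActorName) : A ∈ S.dom ↔ A ∈ S'.dom :=
  not_congr (h.eq_none_iff A)

theorem Config.Rel.exists_of_eq_some {R : ActorName → ActorState → ActorState → Prop}
    {S S' : Config} (h : Config.Rel R S S') {A : ActorName} {a : ActorState} (hA : S A = some a) :
    ∃ a', S' A = some a' ∧ R A a a' := by
  have := h A
  rw [hA] at this
  generalize S' A = o at this
  cases this with
  | some h => exact ⟨_, rfl, h⟩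

theorem Config.Rel.set {R : ActorName → ActorState → ActorState → Prop} {S S' : Config}
    (h : Config.Rel R S S') {A : ActorName} {a a' : ActorState} (ha : R A a a') :
    Config.Rel R (S.set A a) (S'.set A a') := by
  intro B
  rcases eq_or_ne B A with rfl | hB
  · simpa only [Config.set, Function.update_self] using Option.Rel.some ha
  · simpa only [Config.set, Function.update_of_ne hB] using h B

theorem Config.Rel.isFresh {R : ActorName → ActorState → ActorState → Prop} {S S' : Config}
    (h : Config.Rel R S S') {C : ClassName} {i : ℕ} (hi : S.IsFresh C i) : S'.IsFresh C i :=
  ⟨(h.eq_none_iff _).1 hi.1, fun j hj => (not_congr (h.eq_none_iff _)).1 (hi.2 j hj)⟩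

/-- The relation holds between every newly created actor and itself. -/
def ReflOnNew (R : ActorName → ActorState → ActorState → Prop) : Prop :=
  ∀ C i φ, R (.named C i) ⟨.nil, φ, []⟩ ⟨.nil, φ, []⟩

mutual
-- Evaluation consults a configuration only about which names are in use, so it takes the same
-- course in any configuration with the same actors. The relation is left general because both the
-- ordering and the projection to skeletons are instances.
theorem Eval.transport {R : ActorName → ActorState → ActorState → Prop} (hR : ReflOnNew R)
    {S : Config} {E : Expr Value 0} {U : Value} {T : Config} (h : Eval fields φ S E U T)
    {S' : Config} (hS : Config.Rel R S S') :
    ∃ T', Eval fields φ S' E U T' ∧ Config.Rel R T T' := by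
  cases h with
  | value => exact ⟨S', .value _ _, hS⟩
  | field _ f U hf => exact ⟨S', .field _ f U hf, hS⟩
  | new _ T C Es Us i hE hi =>
    obtain ⟨T', hT', hTT'⟩ := EvalList.transport hR hE hS
    exact ⟨_, .new _ _ _ _ _ _ hT' (hTT'.isFresh hi), hTT'.set (hR C i _)⟩
theorem EvalList.transport {R : ActorName → ActorState → ActorState → Prop} (hR : ReflOnNew R)
    {S : Config} {Es : List (Expr Value 0)} {Us : List Value} {T : Config}
    (h : EvalList fields φ S Es Us T) {S' : Config} (hS : Config.Rel R S S') :
    ∃ T', EvalList fields φ S' Es Us T' ∧ Config.Rel R T T' := by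
  cases h with
  | nil => exact ⟨S', .nil _, hS⟩
  | cons _ T R₁ E Es U Us hE hEs =>
    obtain ⟨T', hT', hTT'⟩ := Eval.transport hR hE hS
    obtain ⟨R', hR', hRR'⟩ := EvalList.transport hR hEs hTT'
    exact ⟨R', .cons _ _ _ _ _ _ _ hT' hR', hRR'⟩
end

end

/-! ### Local steps -/

/-- The part of a step other than the instantiation of a method that concerns the process and the
state of the active actor: besides the new process and the new state it yields at most one message
to be delivered, and the configuration extended by the created actors. -/
inductive LocalStep (fields : ClassName → List FieldName) (φ : FieldState) (S : Config) :
    Proc Value 0 → Proc Value 0 → FieldState → Option (ActorName × Message) → Config → Prop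
  | upd {f E P U T} (hE : Eval fields φ S E U T) :
      LocalStep fields φ S (.upd f E P) P (Function.update φ f (some U)) none T
  | letIn {E P U T} (hE : Eval fields φ S E U T) :
      LocalStep fields φ S (.letIn E P) (P.open1 U) φ none T
  | send {B m Es P Us T} (hB : B ∈ S.dom) (hE : EvalList fields φ S Es Us T) :
      LocalStep fields φ S (.send (.free (.act B)) m Es P) P φ (some (B, ⟨m, Us⟩)) T
  | matched {E E' P Q U T} (hE : EvalList fields φ S [E, E'] [U, U] T) :
      LocalStep fields φ S (.cond E E' P Q) P φ none T
  | mismatched {E E' P Q U V T} (hE : EvalList fields φ S [E, E'] [U, V] T) (hUV : U ≠ V) :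
      LocalStep fields φ S (.cond E E' P Q) Q φ none T
  | plusL {P Q} : LocalStep fields φ S (.plus P Q) P φ none S
  | plusR {P Q} : LocalStep fields φ S (.plus P Q) Q φ none S

/-- The messages for an actor. -/
def mailFor (o : Option (ActorName × Message)) (A : ActorName) : List Message :=
  match o with
  | none => []
  | some (B, M) => if A = B then [M] else []

/-- Delivery of a message. -/
def Config.deliver (S : Config) (o : Option (ActorName × Message)) : Config :=
  fun A => (S A).map fun a => ⟨a.proc, a.state, a.queue ++ mailFor o A⟩

@[simp] theorem Config.deliver_none (S : Config) : S.deliver none = S := by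
  funext A
  rw [Config.deliver]
  cases S A <;> simp [mailFor]

theorem Config.dom_deliver (S : Config) (o : Option (ActorName × Message)) :
    (S.deliver o).dom = S.dom := by
  ext A
  simp [Config.dom, Config.deliver]

theorem Config.deliver_eq_some {S : Config} {o : Option (ActorName × Message)} {A : ActorName}
    {a : ActorState} (h : S A = some a) :
    S.deliver o A = some ⟨a.proc, a.state, a.queue ++ mailFor o A⟩ := by
  rw [Config.deliver, h, Option.map_some]

theorem Config.set_self (S : Config) (A : ActorName) (a : ActorState) : S.set A a A = some a :=
  Function.update_self ..

theorem Config.set_of_ne (S : Config) {A B : ActorName} (h : B ≠ A) (a : ActorState) :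
    S.set A a B = S B :=
  Function.update_of_ne h ..

section
variable {fields : ClassName → List FieldName} {φ φ' : FieldState} {S T : Config}
  {P P' : Proc Value 0} {o : Option (ActorName × Message)}

theorem LocalStep.mono (h : LocalStep fields φ S P P' φ' o T) {A : ActorName} {a : ActorState}
    (hA : S A = some a) : T A = some a := by
  cases h with
  | upd hE => exact hE.mono hA
  | letIn hE => exact hE.mono hA
  | send hB hE => exact hE.mono hA
  | matched hE => exact hE.mono hA
  | mismatched hE => exact hE.mono hA
  | plusL => exact hA
  | plusR => exact hA

theorem LocalStep.dom_subset (h : LocalStep fields φ S P P' φ' o T) : S.dom ⊆ T.dom := by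
  intro A hA
  obtain ⟨a, ha⟩ := Config.mem_dom_iff.1 hA
  exact Config.mem_dom_of_eq_some (h.mono ha)

theorem LocalStep.size_lt (h : LocalStep fields φ S P P' φ' o T) : P'.size < P.size := by
  cases h <;> simp only [Proc.size, Proc.size_open1] <;> omega

theorem LocalStep.state_eq (h : LocalStep fields φ S P P' φ' o T) (hP : P.NoUpd) : φ' = φ := by
  cases h with
  | upd => exact hP.elim
  | _ => rfl

theorem LocalStep.noUpd (h : LocalStep fields φ S P P' φ' o T) (hP : P.NoUpd) : P'.NoUpd := by
  cases h with
  | upd => exact hP.elim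
  | letIn => exact (Proc.noUpd_subst _ _).2 hP
  | send => exact hP
  | matched => exact hP.1
  | mismatched => exact hP.2
  | plusL => exact hP.1
  | plusR => exact hP.2

theorem LocalStep.newArity (h : LocalStep fields φ S P P' φ' o T) (hP : P.NewArity fields) :
    P'.NewArity fields := by
  cases h with
  | upd => exact hP.2
  | letIn => exact (Proc.newArity_subst _ _ _).2 hP.2
  | send => exact hP.2
  | matched => exact hP.2.2.1
  | mismatched => exact hP.2.2.2
  | plusL => exact hP.1
  | plusR => exact hP.2

theorem LocalStep.eq_of_noNew (h : LocalStep fields φ S P P' φ' o T) (hP : P.NoNew) : T = S := by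
  cases h with
  | upd hE => exact hE.eq_of_noNew hP.1
  | letIn hE => exact hE.eq_of_noNew hP.1
  | send hB hE => exact hE.eq_of_noNew hP.1
  | matched hE => exact hE.eq_of_noNew (by simpa using ⟨hP.1, hP.2.1⟩)
  | mismatched hE => exact hE.eq_of_noNew (by simpa using ⟨hP.1, hP.2.1⟩)
  | plusL => rfl
  | plusR => rfl

theorem LocalStep.transport {R : ActorName → ActorState → ActorState → Prop} (hR : ReflOnNew R)
    (h : LocalStep fields φ S P P' φ' o T) {S' : Config} (hS : Config.Rel R S S') :
    ∃ T', LocalStep fields φ S' P P' φ' o T' ∧ Config.Rel R T T' := by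
  cases h with
  | upd hE => obtain ⟨T', h, h'⟩ := hE.transport hR hS; exact ⟨T', .upd h, h'⟩
  | letIn hE => obtain ⟨T', h, h'⟩ := hE.transport hR hS; exact ⟨T', .letIn h, h'⟩
  | send hB hE =>
    obtain ⟨T', h, h'⟩ := hE.transport hR hS
    exact ⟨T', .send ((hS.mem_dom_iff _).1 hB) h, h'⟩
  | matched hE => obtain ⟨T', h, h'⟩ := hE.transport hR hS; exact ⟨T', .matched h, h'⟩
  | mismatched hE hUV =>
    obtain ⟨T', h, h'⟩ := hE.transport hR hS
    exact ⟨T', .mismatched h hUV, h'⟩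
  | plusL => exact ⟨S', .plusL, hS⟩
  | plusR => exact ⟨S', .plusR, hS⟩

/-- Local steps without creation of actors commute with permutations that fix the actor names and
the state. -/
theorem LocalStep.rename (h : LocalStep fields φ S P P' φ' o T) (hP : P.NoNew) (hP' : P.NoUpd)
    {θ : Value → Value} (hθ : Function.Injective θ) (hact : ∀ A, θ (.act A) = .act A)
    (hφ : ∀ f V, φ f = some V → θ V = V) {S' : Config} (hS : S.dom ⊆ S'.dom) :
    LocalStep fields φ S' (P.rename θ) (P'.rename θ) φ'
      (o.map fun m => (m.1, ⟨m.2.name, m.2.args.map θ⟩)) S' := by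
  cases h with
  | upd => exact hP'.elim
  | letIn hE =>
    rw [Proc.rename_open1, Proc.rename_letIn]
    exact .letIn (hE.rename hP.1 hφ S')
  | @send B _ _ _ _ _ hB hE =>
    rw [Proc.rename_send, Name.rename, hact]
    exact .send (hS hB) (hE.rename hP.1 hφ S')
  | matched hE => exact .matched (hE.rename (by simpa using ⟨hP.1, hP.2.1⟩) hφ S')
  | mismatched hE hUV =>
    exact .mismatched (hE.rename (by simpa using ⟨hP.1, hP.2.1⟩) hφ S') (hθ.ne hUV)
  | plusL => exact .plusL
  | plusR => exact .plusR

/-- By determinism of evaluation, only conditionals and sums are treated as offering two candidate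
continuations; every other process has at most one. -/
theorem LocalStep.finite (fields : ClassName → List FieldName) (φ : FieldState) (S : Config)
    (P : Proc Value 0) :
    {x : Proc Value 0 × FieldState × Option (ActorName × Message) × Config |
      LocalStep fields φ S P x.1 x.2.1 x.2.2.1 x.2.2.2}.Finite := by
  cases P with
  | nil => exact (Set.finite_empty).subset fun x hx => by cases hx
  | upd f E P =>
    refine Set.Subsingleton.finite ?_
    rintro ⟨P₁, φ₁, o₁, T₁⟩ h₁ ⟨P₂, φ₂, o₂, T₂⟩ h₂
    cases h₁ with | upd hE₁ => cases h₂ with | upd hE₂ =>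
    obtain ⟨rfl, rfl⟩ := hE₁.unique hE₂
    rfl
  | letIn E P =>
    by_cases hex : ∃ U T, Eval fields φ S E U T
    · obtain ⟨U, T, hT⟩ := hex
      refine (Set.finite_singleton (P.open1 U, φ, none, T)).subset ?_
      rintro ⟨P₁, φ₁, o₁, T₁⟩ h₁
      cases h₁ with
      | letIn hE₁ =>
        obtain ⟨rfl, h⟩ := hE₁.unique hT
        obtain rfl : T₁ = T := h
        rfl
    · refine (Set.finite_empty).subset ?_
      rintro ⟨P₁, φ₁, o₁, T₁⟩ h₁
      cases h₁ with
      | letIn hE₁ => exact hex ⟨_, _, hE₁⟩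
  | send x m Es P =>
    refine Set.Subsingleton.finite ?_
    rintro ⟨P₁, φ₁, o₁, T₁⟩ h₁ ⟨P₂, φ₂, o₂, T₂⟩ h₂
    cases h₁ with | send hB₁ hE₁ => cases h₂ with | send hB₂ hE₂ =>
    obtain ⟨rfl, rfl⟩ := hE₁.unique hE₂
    rfl
  | cond E E' P Q =>
    by_cases hex : ∃ Us T, EvalList fields φ S [E, E'] Us T
    · obtain ⟨Us, T, hT⟩ := hex
      refine (Set.toFinite {(P, φ, none, T), (Q, φ, none, T)}).subset ?_
      rintro ⟨P₁, φ₁, o₁, T₁⟩ h₁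
      cases h₁ with
      | matched hE₁ => obtain rfl : T₁ = T := (hE₁.unique hT).2; exact .inl rfl
      | mismatched hE₁ => obtain rfl : T₁ = T := (hE₁.unique hT).2; exact .inr rfl
    · refine (Set.finite_empty).subset ?_
      rintro ⟨P₁, φ₁, o₁, T₁⟩ h₁
      cases h₁ with
      | matched hE₁ => exact hex ⟨_, _, hE₁⟩
      | mismatched hE₁ => exact hex ⟨_, _, hE₁⟩
  | plus P Q =>
    refine (Set.toFinite {(P, φ, none, S), (Q, φ, none, S)}).subset ?_
    rintro ⟨P₁, φ₁, o₁, T₁⟩ h₁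
    cases h₁ with
    | plusL => exact .inl rfl
    | plusR => exact .inr rfl

end

/-- Separating delivery from the local step merges invocations of oneself and of others, so later
arguments about steps have two cases only: a local step or an instantiation. -/
theorem Program.step_iff (p : Program) (S S' : Config) :
    p.Step S S' ↔
      (∃ A P φ q P' φ' o T, S A = some ⟨P, φ, q⟩ ∧ LocalStep p.fields φ S P P' φ' o T ∧
        S' = (T.set A ⟨P', φ', q⟩).deliver o) ∨
      ∃ C i d φ q Us, S (.named C i) = some ⟨.nil, φ, ⟨d.name, Us⟩ :: q⟩ ∧ d ∈ p.defs ∧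
        d.cls = C ∧ Us.length = d.params.length ∧
        S' = S.set (.named C i) ⟨d.body.rename (p.instSubst S d (.named C i) Us), φ, q⟩ := by
  have self (T : Config) (A : ActorName) (P φ q M) :
      (T.set A ⟨P, φ, q⟩).deliver (some (A, M)) = T.set A ⟨P, φ, q ++ [M]⟩ := by
    funext B
    rcases eq_or_ne B A with rfl | hB
    · rw [Config.deliver_eq_some (Config.set_self ..), Config.set_self]
      simp [mailFor]
    · rw [Config.deliver, Config.set_of_ne _ hB, Config.set_of_ne _ hB]
      cases T B <;> simp [mailFor, hB]
  have other (T : Config) (A B : ActorName) (hAB : A ≠ B) (P φ q P' φ' q' M)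
      (hB : T B = some ⟨P', φ', q'⟩) :
      (T.set A ⟨P, φ, q⟩).deliver (some (B, M)) =
        (T.set A ⟨P, φ, q⟩).set B ⟨P', φ', q' ++ [M]⟩ := by
    funext D
    rcases eq_or_ne D B with rfl | hD
    · rw [Config.set_self,
        Config.deliver_eq_some ((Config.set_of_ne _ hAB.symm _).trans hB)]
      simp [mailFor]
    · rw [Config.set_of_ne _ hD, Config.deliver]
      cases T.set A ⟨P, φ, q⟩ D <;> simp [mailFor, hD]
  constructor
  · rintro h
    cases h with
    | upd T A f E P φ q U hA hE =>
      exact .inl ⟨A, _, φ, q, P, _, none, T, hA, .upd hE, (Config.deliver_none _).symm⟩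
    | letIn T A E P φ q U hA hE =>
      exact .inl ⟨A, _, φ, q, _, _, none, T, hA, .letIn hE, (Config.deliver_none _).symm⟩
    | invkSelf T A m Es P φ q Us hA hE =>
      exact .inl ⟨A, _, φ, q, P, _, _, T, hA, .send (Config.mem_dom_of_eq_some hA) hE,
        (self ..).symm⟩
    -- The rule reads the term of `B` before the evaluation and delivery reads it afterwards;
    -- evaluation leaves existing terms unchanged.
    | invk T A B m Es P P' φ φ' q q' Us hAB hA hB hE =>
      exact .inl ⟨A, _, φ, q, P, _, _, T, hA, .send (Config.mem_dom_of_eq_some hB) hE,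
        (other _ _ _ hAB _ _ _ _ _ _ _ (hE.mono hB)).symm⟩
    | inst C i d φ q Us hA hd hC hU => exact .inr ⟨C, i, d, φ, q, Us, hA, hd, hC, hU, rfl⟩
    | matched T A E E' P Q φ q U hA hE =>
      exact .inl ⟨A, _, φ, q, _, _, none, T, hA, .matched hE, (Config.deliver_none _).symm⟩
    | mismatched T A E E' P Q φ q U V hA hE hUV =>
      exact .inl ⟨A, _, φ, q, _, _, none, T, hA, .mismatched hE hUV, (Config.deliver_none _).symm⟩
    | plusL A P Q φ q hA =>
      exact .inl ⟨A, _, φ, q, _, _, none, S, hA, .plusL, (Config.deliver_none _).symm⟩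
    | plusR A P Q φ q hA =>
      exact .inl ⟨A, _, φ, q, _, _, none, S, hA, .plusR, (Config.deliver_none _).symm⟩
  · rintro (⟨A, P, φ, q, P', φ', o, T, hA, h, rfl⟩ | ⟨C, i, d, φ, q, Us, hA, hd, hC, hU, rfl⟩)
    · cases h with
      | upd hE => rw [Config.deliver_none]; exact .upd _ _ _ _ _ _ _ _ _ hA hE
      | letIn hE => rw [Config.deliver_none]; exact .letIn _ _ _ _ _ _ _ _ hA hE
      | @send B m Es _ Us _ hB hE =>
        rcases eq_or_ne A B with rfl | hAB
        · rw [self]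
          exact .invkSelf _ _ _ _ _ _ _ _ _ hA hE
        · obtain ⟨⟨Q, ψ, q'⟩, hB⟩ := Config.mem_dom_iff.1 hB
          rw [other _ _ _ hAB _ _ _ _ _ _ _ (hE.mono hB)]
          exact .invk _ _ _ _ _ _ _ _ _ _ _ _ _ hAB hA hB hE
      | matched hE => rw [Config.deliver_none]; exact .matched _ _ _ _ _ _ _ _ _ _ hA hE
      | mismatched hE hUV =>
        rw [Config.deliver_none]; exact .mismatched _ _ _ _ _ _ _ _ _ _ _ hA hE hUV
      | plusL => rw [Config.deliver_none]; exact .plusL _ _ _ _ _ _ hA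
      | plusR => rw [Config.deliver_none]; exact .plusR _ _ _ _ _ _ hA
    · exact .inst _ _ _ _ _ _ _ hA hd hC hU

theorem Program.finite_step (p : Program) {S : Config} (hS : S.dom.Finite) :
    {T | p.Step S T}.Finite := by
  have hs (A : ActorName) : {a | S A = some a}.Finite :=
    Set.Subsingleton.finite fun a ha b hb => Option.some.inj (ha.symm.trans hb)
  have hl : (⋃ A ∈ S.dom, ⋃ a ∈ {a | S A = some a},
      (fun x : Proc Value 0 × FieldState × Option (ActorName × Message) × Config =>
        (x.2.2.2.set A ⟨x.1, x.2.1, a.queue⟩).deliver x.2.2.1) ''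
        {x | LocalStep p.fields a.state S a.proc x.1 x.2.1 x.2.2.1 x.2.2.2}).Finite :=
    hS.biUnion fun A _ => (hs A).biUnion fun a _ => (LocalStep.finite _ _ _ _).image _
  -- A finite superset of the instantiations: the arguments are read off the head of the queue, with
  -- an arbitrary default when it is empty, and no match between message and method is required.
  have hi : (⋃ A ∈ S.dom, ⋃ a ∈ {a | S A = some a}, (fun d : MethodDef =>
      S.set A ⟨d.body.rename (p.instSubst S d A (a.queue.head?.elim [] Message.args)),
        a.state, a.queue.tail⟩) '' (p.defs : Set MethodDef)).Finite :=
    hS.biUnion fun A _ => (hs A).biUnion fun a _ => p.defs.finite_toSet.image _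
  refine (hl.union hi).subset fun S' h => ?_
  rcases (p.step_iff S S').1 h with ⟨A, P, φ, q, P', φ', o, T, hA, hl, rfl⟩ |
    ⟨C, i, d, φ, q, Us, hA, hd, hC, hU, rfl⟩
  · exact .inl (Set.mem_biUnion (Config.mem_dom_of_eq_some hA)
      (Set.mem_biUnion hA ⟨(P', φ', o, T), hl, rfl⟩))
  · exact .inr (Set.mem_biUnion (Config.mem_dom_of_eq_some hA)
      (Set.mem_biUnion hA ⟨d, hd, rfl⟩))

/-! ### Association lists -/

section
variable {α β : Type} [BEq α] [LawfulBEq α]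

theorem mem_of_lookup_zip {ks : List α} {vs : List β} {k : α} {v : β}
    (h : (ks.zip vs).lookup k = some v) : k ∈ ks ∧ v ∈ vs := by
  obtain ⟨l₁, l₂, h, -⟩ := List.lookup_eq_some_iff.1 h
  exact List.of_mem_zip (h ▸ by simp)

theorem exists_lookup_zip {ks : List α} {vs : List β} {k : α} (hl : vs.length = ks.length)
    (hk : k ∈ ks) : ∃ v, (ks.zip vs).lookup k = some v := by
  rw [← Option.isSome_iff_exists, List.lookup_isSome_iff]
  obtain ⟨i, hi, rfl⟩ := List.mem_iff_getElem.1 hk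
  exact ⟨(ks[i], vs[i]), List.mem_iff_getElem.2 ⟨i, by simp [hl, hi], by simp⟩, by simp⟩

end

theorem lookup_zip_map {α β γ : Type} [BEq α] (ks : List α) (vs : List β) (f : β → γ) (k : α) :
    (ks.zip (vs.map f)).lookup k = ((ks.zip vs).lookup k).map f := by
  induction ks generalizing vs with
  | nil => rfl
  | cons k' ks ih =>
    cases vs with
    | nil => rfl
    | cons v vs =>
      simp only [List.map_cons, List.zip_cons_cons, List.lookup_cons, ih]
      split <;> rfl

/-! ### Residuals of method bodies -/

instance : Infinite Value :=
  Infinite.of_injective Value.var fun _ _ h => Value.var.inj h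

/-- The processes that remain after one operator, the variable of a `let` being replaced by a fresh
one. -/
inductive Proc.Residual : Proc Value 0 → Proc Value 0 → Prop
  | upd (f E P) : Proc.Residual (.upd f E P) P
  | letIn (E) (P : Proc Value 1) :
      Proc.Residual (.letIn E P) (P.open1 (Infinite.exists_notMem_finset P.fv).choose)
  | send (x m Es P) : Proc.Residual (.send x m Es P) P
  | condL (E E' P Q) : Proc.Residual (.cond E E' P Q) P
  | condR (E E' P Q) : Proc.Residual (.cond E E' P Q) Q
  | plusL (P Q) : Proc.Residual (.plus P Q) P
  | plusR (P Q) : Proc.Residual (.plus P Q) Q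

theorem Proc.Residual.size_lt {P Q : Proc Value 0} (h : P.Residual Q) : Q.size < P.size := by
  cases h <;> simp only [Proc.size, Proc.size_open1] <;> omega

theorem Proc.Residual.finite (P : Proc Value 0) : {Q | P.Residual Q}.Finite := by
  cases P with
  | nil => exact Set.finite_empty.subset fun Q h => by cases h
  | upd f E P => exact (Set.finite_singleton P).subset fun Q h => by cases h; rfl
  | letIn E P =>
    exact (Set.finite_singleton (P.open1 _)).subset fun Q h => by cases h; rfl
  | send x m Es P => exact (Set.finite_singleton P).subset fun Q h => by cases h; rfl
  | cond E E' P Q => exact (Set.toFinite {P, Q}).subset fun Q h => by cases h <;> simp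
  | plus P Q => exact (Set.toFinite {P, Q}).subset fun Q h => by cases h <;> simp

/-- A finitely branching relation that decreases a measure reaches finitely many elements only. -/
theorem finite_reflTransGen {α : Type*} {r : α → α → Prop} (μ : α → ℕ)
    (hμ : ∀ a b, r a b → μ b < μ a) {good : Set α} (hgood : ∀ a ∈ good, ∀ b, r a b → b ∈ good)
    (hr : ∀ a ∈ good, {b | r a b}.Finite) (a : α) (ha : a ∈ good) :
    {b | Relation.ReflTransGen r a b}.Finite := by
  induction hn : μ a using Nat.strong_induction_on generalizing a with
  | _ n ih =>
    have : (⋃ b ∈ {b | r a b}, {c | Relation.ReflTransGen r b c}).Finite :=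
      (hr a ha).biUnion fun b hb => ih (μ b) (hn ▸ hμ a b hb) b (hgood a ha b hb) rfl
    refine (this.insert a).subset fun c hc => ?_
    rcases Relation.ReflTransGen.cases_head hc with rfl | ⟨b, hab, hbc⟩
    · exact .inl rfl
    · exact .inr (Set.mem_biUnion hab hbc)

theorem Proc.finite_residuals (P : Proc Value 0) :
    {Q | Relation.ReflTransGen Proc.Residual P Q}.Finite :=
  finite_reflTransGen Proc.size (fun _ _ => Proc.Residual.size_lt) (good := Set.univ)
    (fun _ _ _ _ => trivial) (fun P _ => Proc.Residual.finite P) P trivial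

/-- A step only peels off the outermost operator, and the value it may bind goes into the new
renaming `σ'`. So a process keeps being an instance of one of the finitely many residuals of its
method body. -/
theorem LocalStep.residual {fields : ClassName → List FieldName} {φ φ' : FieldState} {S T : Config}
    {P P' : Proc Value 0} {o : Option (ActorName × Message)}
    (h : LocalStep fields φ S P P' φ' o T) {Q : Proc Value 0} {σ : Value → Value}
    (hP : P = Q.rename σ) : ∃ Q' σ', Q.Residual Q' ∧ P' = Q'.rename σ' := by
  cases Q with
  | nil => subst hP; cases h
  | upd f E Q =>
    rw [Proc.rename_upd] at hP
    subst hP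
    cases h
    exact ⟨_, σ, .upd .., rfl⟩
  | letIn E Q =>
    rw [Proc.rename_letIn] at hP
    subst hP
    cases h
    exact ⟨_, _, .letIn .., Q.open1_rename_update σ
      (Infinite.exists_notMem_finset Q.fv).choose_spec _⟩
  | send x m Es Q =>
    rw [Proc.rename_send] at hP
    -- The target is abstracted so that the case analysis can identify it with an actor name.
    generalize x.rename σ = y at hP
    subst hP
    cases h
    exact ⟨_, σ, .send .., rfl⟩
  | cond E E' Q R =>
    rw [Proc.rename_cond] at hP
    subst hP
    cases h
    · exact ⟨_, σ, .condL .., rfl⟩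
    · exact ⟨_, σ, .condR .., rfl⟩
  | plus Q R =>
    rw [Proc.rename_plus] at hP
    subst hP
    cases h
    · exact ⟨_, σ, .plusL .., rfl⟩
    · exact ⟨_, σ, .plusR .., rfl⟩

/-- The instances of the residuals of the methods of a class. -/
def Program.Running (p : Program) (C : ClassName) (P : Proc Value 0) : Prop :=
  P = .nil ∨ ∃ d ∈ p.defs, d.cls = C ∧ ∃ Q σ,
    Relation.ReflTransGen Proc.Residual (d.body.rename Value.var) Q ∧ P = Q.rename σ

theorem LocalStep.running {p : Program} {C : ClassName} {φ φ' : FieldState} {S T : Config}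
    {P P' : Proc Value 0} {o : Option (ActorName × Message)}
    (h : LocalStep p.fields φ S P P' φ' o T) (hP : p.Running C P) : p.Running C P' := by
  rcases hP with rfl | ⟨d, hd, hC, Q, σ, hQ, hP⟩
  · cases h
  · obtain ⟨Q', σ', hQ', hP'⟩ := h.residual hP
    exact .inr ⟨d, hd, hC, Q', σ', hQ.tail hQ', hP'⟩

/-! ### Invariants of the reachable configurations -/

section
variable {fields : ClassName → List FieldName} {φ φ' : FieldState} {S T : Config}
  {P P' : Proc Value 0} {o : Option (ActorName × Message)}

theorem LocalStep.noNew (h : LocalStep fields φ S P P' φ' o T) (hP : P.NoNew) : P'.NoNew := by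
  cases h with
  | upd => exact hP.2
  | letIn => exact (Proc.noNew_subst _ _).2 hP.2
  | send => exact hP.2
  | matched => exact hP.2.2.1
  | mismatched => exact hP.2.2.2
  | plusL => exact hP.1
  | plusR => exact hP.2

theorem LocalStep.fieldNames_subset (h : LocalStep fields φ S P P' φ' o T) :
    P'.fieldNames ⊆ P.fieldNames := by
  intro f hf
  cases h with
  | letIn =>
    rw [Proc.open1, Proc.fieldNames_subst] at hf
    simp [Proc.fieldNames, hf]
  | _ => simp [Proc.fieldNames, hf]

end

/-- The value is a variable or the name of an actor in `D` other than the root. -/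
def KnownIn (D : Set ActorName) : Value → Prop
  | .var _ => True
  | .act B => B ≠ .root ∧ B ∈ D

theorem KnownIn.mono {D D' : Set ActorName} (h : D ⊆ D') {v : Value} (hv : KnownIn D v) :
    KnownIn D' v := by
  cases v with
  | var => trivial
  | act B => exact ⟨hv.1, h hv.2⟩

/-- The invariant of a term in a configuration with actors `D`. -/
structure Program.ActorInv (p : Program) (D : Set ActorName) (A : ActorName) (a : ActorState) :
    Prop where
  proc_known : ∀ v ∈ a.proc.fv, KnownIn D v
  state_known : ∀ f v, a.state f = some v → KnownIn D v ∧ p.Rigid v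
  queue_known : ∀ M ∈ a.queue, ∀ v ∈ M.args, KnownIn D v
  noUpd : a.proc.NoUpd
  newArity : a.proc.NewArity p.fields
  root : A = .root → a.queue = [] ∧ a.state = (fun _ => none) ∧ ∀ v ∈ a.proc.fv, p.Rigid v
  named : ∀ C i, A = .named C i → (∀ f ∈ p.fields C, ∃ v, a.state f = some v) ∧
    a.proc.NoNew ∧ (∀ f ∈ a.proc.fieldNames, f ∈ p.fields C) ∧ p.Running C a.proc

/-- The invariant of a configuration. -/
structure Program.Inv (p : Program) (S : Config) : Prop where
  finite_dom : S.dom.Finite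
  root_mem : .root ∈ S.dom
  actor : ∀ A a, S A = some a → p.ActorInv S.dom A a

section
variable {p : Program}

theorem Program.ActorInv.mono {D D' : Set ActorName} (h : D ⊆ D') {A : ActorName} {a : ActorState}
    (ha : p.ActorInv D A a) : p.ActorInv D' A a where
  proc_known v hv := (ha.proc_known v hv).mono h
  state_known f v hv := ⟨(ha.state_known f v hv).1.mono h, (ha.state_known f v hv).2⟩
  queue_known M hM v hv := (ha.queue_known M hM v hv).mono h
  noUpd := ha.noUpd
  newArity := ha.newArity
  root := ha.root
  named := ha.named

theorem Program.ActorInv.newActor {D : Set ActorName} {C : ClassName} {i : ℕ} {Us : List Value}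
    (hl : Us.length = (p.fields C).length) (hUs : ∀ U ∈ Us, KnownIn D U ∧ p.Rigid U) :
    p.ActorInv D (.named C i) ⟨.nil, FieldState.init (p.fields C) Us, []⟩ where
  proc_known v hv := absurd hv (Finset.notMem_empty _)
  state_known f v hv := hUs v (mem_of_lookup_zip hv).2
  queue_known M hM := absurd hM List.not_mem_nil
  noUpd := trivial
  newArity := trivial
  root h := ActorName.noConfusion h
  named C' i' h := by
    cases h
    exact ⟨fun f hf => exists_lookup_zip hl hf, trivial,
      fun f hf => absurd hf (Finset.notMem_empty _), .inl rfl⟩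

theorem Program.Inv.set {S : Config} (hS : p.Inv S) {A : ActorName} {a : ActorState}
    (ha : p.ActorInv (insert A S.dom) A a) : p.Inv (S.set A a) where
  finite_dom := by
    rw [Config.dom_set]
    exact hS.finite_dom.insert A
  root_mem := by
    rw [Config.dom_set]
    exact .inr hS.root_mem
  actor B b hb := by
    rw [Config.dom_set]
    rcases eq_or_ne B A with rfl | hB
    · rw [Config.set_self] at hb
      exact Option.some.inj hb ▸ ha
    · rw [Config.set_of_ne _ hB] at hb
      exact (hS.actor B b hb).mono (Set.subset_insert _ _)

theorem Program.Inv.deliver {S : Config} (hS : p.Inv S) {o : Option (ActorName × Message)}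
    (ho : ∀ B M, o = some (B, M) → B ≠ .root ∧ ∀ v ∈ M.args, KnownIn S.dom v) :
    p.Inv (S.deliver o) where
  finite_dom := by
    rw [Config.dom_deliver]
    exact hS.finite_dom
  root_mem := by
    rw [Config.dom_deliver]
    exact hS.root_mem
  actor A a' ha' := by
    rw [Config.dom_deliver]
    obtain ⟨a, ha, rfl⟩ := Option.map_eq_some_iff.1 ha'
    have h := hS.actor A a ha
    have hmail : ∀ M ∈ mailFor o A, o = some (A, M) := by
      rcases o with _ | ⟨B, N⟩ <;> intro M hM
      · exact absurd hM List.not_mem_nil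
      · rw [mailFor] at hM
        split_ifs at hM with hAB <;> simp_all
    exact
      { proc_known := h.proc_known
        state_known := h.state_known
        queue_known := fun M hM v hv => by
          rcases List.mem_append.1 hM with hM | hM
          · exact h.queue_known M hM v hv
          · exact (ho A M (hmail M hM)).2 v hv
        noUpd := h.noUpd
        newArity := h.newArity
        root := by
          rintro rfl
          refine ⟨?_, (h.root rfl).2⟩
          rw [(h.root rfl).1, List.nil_append]
          exact List.eq_nil_iff_forall_not_mem.2 fun M hM => (ho _ M (hmail M hM)).1 rfl
        named := h.named }

mutual
-- The alternative `hn` reflects the two kinds of code: methods contain no `new`, and the root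
-- process has rigid names only. Hence whatever is stored in a new actor is rigid.
theorem Program.Inv.eval {φ : FieldState} {S : Config} (hS : p.Inv S)
    (hφ : ∀ f v, φ f = some v → KnownIn S.dom v ∧ p.Rigid v)
    {E : Expr Value 0} {U : Value} {T : Config} (h : Eval p.fields φ S E U T)
    (hE : ∀ v ∈ E.fv, KnownIn S.dom v) (ha : E.NewArity p.fields)
    (hn : E.NoNew ∨ ∀ v ∈ E.fv, p.Rigid v) :
    p.Inv T ∧ S.dom ⊆ T.dom ∧ KnownIn T.dom U ∧ ((∀ v ∈ E.fv, p.Rigid v) → p.Rigid U) := by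
  cases h with
  | value => exact ⟨hS, subset_rfl, hE U (Finset.mem_singleton_self U),
      fun h => h U (Finset.mem_singleton_self U)⟩
  | field _ f U hf => exact ⟨hS, subset_rfl, (hφ f U hf).1, fun _ => (hφ f U hf).2⟩
  | new _ T C Es Us i h hi =>
    have hr := hn.resolve_left id
    obtain ⟨hT, hST, hl, hUs, hUs'⟩ := Program.Inv.evalList hS hφ h hE ha.2 (.inr hr)
    refine ⟨hT.set (.newActor (hl.trans ha.1) fun U hU => ⟨?_, hUs' hr U hU⟩), ?_, ?_, ?_⟩
    · exact (hUs U hU).mono (Set.subset_insert _ _)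
    · rw [Config.dom_set]
      exact hST.trans (Set.subset_insert _ _)
    · rw [Config.dom_set]
      exact ⟨ActorName.noConfusion, .inl rfl⟩
    · exact fun _ => trivial
theorem Program.Inv.evalList {φ : FieldState} {S : Config} (hS : p.Inv S)
    (hφ : ∀ f v, φ f = some v → KnownIn S.dom v ∧ p.Rigid v)
    {Es : List (Expr Value 0)} {Us : List Value} {T : Config} (h : EvalList p.fields φ S Es Us T)
    (hE : ∀ v ∈ Expr.fvList Es, KnownIn S.dom v) (ha : Expr.NewArityList p.fields Es)
    (hn : (∀ E ∈ Es, E.NoNew) ∨ ∀ v ∈ Expr.fvList Es, p.Rigid v) :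
    p.Inv T ∧ S.dom ⊆ T.dom ∧ Us.length = Es.length ∧ (∀ U ∈ Us, KnownIn T.dom U) ∧
      ((∀ v ∈ Expr.fvList Es, p.Rigid v) → ∀ U ∈ Us, p.Rigid U) := by
  cases h with
  | nil => exact ⟨hS, subset_rfl, rfl, by simp, by simp⟩
  | cons _ R _ E Es U Us h h' =>
    simp only [Expr.fvList, Finset.mem_union] at hE hn ⊢
    obtain ⟨hR, hSR, hU, hU'⟩ := Program.Inv.eval hS hφ h (fun v hv => hE v (.inl hv)) ha.1
      (hn.imp (fun h => h E List.mem_cons_self) fun h v hv => h v (.inl hv))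
    obtain ⟨hT, hRT, hl, hUs, hUs'⟩ := Program.Inv.evalList hR
      (fun f v hv => ⟨(hφ f v hv).1.mono hSR, (hφ f v hv).2⟩) h'
      (fun v hv => (hE v (.inr hv)).mono hSR) ha.2
      (hn.imp (fun h E' hE' => h E' (List.mem_cons_of_mem _ hE')) fun h v hv => h v (.inr hv))
    refine ⟨hT, hSR.trans hRT, by simp [hl], ?_, fun hr => ?_⟩
    · rw [List.forall_mem_cons]
      exact ⟨hU.mono hRT, hUs⟩
    · rw [List.forall_mem_cons]
      exact ⟨hU' fun v hv => hr v (.inl hv), hUs' fun v hv => hr v (.inr hv)⟩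
end

theorem Program.Inv.localStep {φ φ' : FieldState} {S T : Config} (hS : p.Inv S)
    (hφ : ∀ f v, φ f = some v → KnownIn S.dom v ∧ p.Rigid v)
    {P P' : Proc Value 0} {o : Option (ActorName × Message)}
    (h : LocalStep p.fields φ S P P' φ' o T)
    (hP : ∀ v ∈ P.fv, KnownIn S.dom v) (ha : P.NewArity p.fields) (hu : P.NoUpd)
    (hn : P.NoNew ∨ ∀ v ∈ P.fv, p.Rigid v) :
    p.Inv T ∧ (∀ v ∈ P'.fv, KnownIn T.dom v) ∧
      ((∀ v ∈ P.fv, p.Rigid v) → ∀ v ∈ P'.fv, p.Rigid v) ∧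
      ∀ B M, o = some (B, M) → B ≠ .root ∧ ∀ v ∈ M.args, KnownIn T.dom v := by
  cases h with
  | upd => exact hu.elim
  | @letIn E P U T h =>
    simp only [Proc.fv, Finset.mem_union] at hP hn ⊢
    obtain ⟨hT, hST, hU, hU'⟩ := hS.eval hφ h (fun v hv => hP v (.inl hv)) ha.1
      (hn.imp And.left fun h v hv => h v (.inl hv))
    refine ⟨hT, fun v hv => ?_, fun hr v hv => ?_, by simp⟩ <;>
      rcases Finset.mem_insert.1 (P.fv_open1_subset U hv) with rfl | hv
    · exact hU
    · exact (hP v (.inr hv)).mono hST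
    · exact hU' fun w hw => hr w (.inl hw)
    · exact hr v (.inr hv)
  | @send B m Es P Us T hB h =>
    simp only [Proc.fv, Finset.mem_union] at hP hn ⊢
    obtain ⟨hT, hST, -, hUs, -⟩ := hS.evalList hφ h (fun v hv => hP v (.inl (.inr hv))) ha.1
      (hn.imp And.left fun h v hv => h v (.inl (.inr hv)))
    refine ⟨hT, fun v hv => (hP v (.inr hv)).mono hST, fun hr v hv => hr v (.inr hv), ?_⟩
    rintro B' M ⟨⟩
    -- The target is a free name of the process, hence known, and the root is never known: its queue
    -- stays empty.
    exact ⟨(hP (.act B) (.inl (.inl (Finset.mem_singleton_self _)))).1, hUs⟩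
  | @matched E E' P Q U T h =>
    simp only [Proc.fv, Finset.mem_union] at hP hn ⊢
    obtain ⟨hT, hST, -⟩ := hS.evalList hφ h
      (by simp only [Expr.fvList, Finset.mem_union, Finset.notMem_empty, or_false]
          exact fun v hv => hP v (.inl (.inl hv))) ⟨ha.1, ha.2.1, trivial⟩
      (by simp only [Expr.fvList, Finset.mem_union, Finset.notMem_empty, or_false]
          exact hn.imp (fun h => by simpa using ⟨h.1, h.2.1⟩) fun h v hv => h v (.inl (.inl hv)))
    exact ⟨hT, fun v hv => (hP v (.inl (.inr hv))).mono hST, fun hr v hv => hr v (.inl (.inr hv)),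
      by simp⟩
  | @mismatched E E' P Q U V T h _ =>
    simp only [Proc.fv, Finset.mem_union] at hP hn ⊢
    obtain ⟨hT, hST, -⟩ := hS.evalList hφ h
      (by simp only [Expr.fvList, Finset.mem_union, Finset.notMem_empty, or_false]
          exact fun v hv => hP v (.inl (.inl hv))) ⟨ha.1, ha.2.1, trivial⟩
      (by simp only [Expr.fvList, Finset.mem_union, Finset.notMem_empty, or_false]
          exact hn.imp (fun h => by simpa using ⟨h.1, h.2.1⟩) fun h v hv => h v (.inl (.inl hv)))
    exact ⟨hT, fun v hv => (hP v (.inr hv)).mono hST, fun hr v hv => hr v (.inr hv), by simp⟩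
  | plusL =>
    simp only [Proc.fv, Finset.mem_union] at hP ⊢
    exact ⟨hS, fun v hv => hP v (.inl hv), fun hr v hv => hr v (.inl hv), by simp⟩
  | plusR =>
    simp only [Proc.fv, Finset.mem_union] at hP ⊢
    exact ⟨hS, fun v hv => hP v (.inr hv), fun hr v hv => hr v (.inr hv), by simp⟩

theorem Program.ActorInv.noNew_or_rigid {D : Set ActorName} {A : ActorName} {a : ActorState}
    (h : p.ActorInv D A a) : a.proc.NoNew ∨ ∀ v ∈ a.proc.fv, p.Rigid v := by
  cases A with
  | root => exact .inr (h.root rfl).2.2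
  | named C i => exact .inl (h.named C i rfl).2.1

theorem Program.Inv.step (hc : p.Correct) (hr : p.ReadOnly) (hb : p.BoundedActors)
    {S S' : Config} (hS : p.Inv S) (h : p.Step S S') : p.Inv S' := by
  rcases (p.step_iff S S').1 h with ⟨A, P, φ, q, P', φ', o, T, hA, hl, rfl⟩ |
    ⟨C, i, d, φ, q, Us, hA, hd, hC, hU, rfl⟩
  · have ha := hS.actor A _ hA
    obtain rfl := hl.state_eq ha.noUpd
    obtain ⟨hT, hP', hrig, ho⟩ := hS.localStep ha.state_known hl ha.proc_known ha.newArity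
      ha.noUpd ha.noNew_or_rigid
    have hAT := hl.dom_subset (Config.mem_dom_of_eq_some hA)
    have hdom (a : ActorState) : (T.set A a).dom = T.dom := by
      rw [Config.dom_set, Set.insert_eq_of_mem hAT]
    refine (hT.set ?_).deliver (by rwa [hdom])
    rw [Set.insert_eq_of_mem hAT]
    have ha' := ha.mono hl.dom_subset
    exact
      { proc_known := hP'
        state_known := ha'.state_known
        queue_known := ha'.queue_known
        noUpd := hl.noUpd ha.noUpd
        newArity := hl.newArity ha.newArity
        root := fun h => ⟨(ha.root h).1, (ha.root h).2.1, hrig (ha.root h).2.2⟩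
        named := fun C i h => by
          obtain ⟨h₁, h₂, h₃, h₄⟩ := ha.named C i h
          exact ⟨h₁, hl.noNew h₂, fun f hf => h₃ f (hl.fieldNames_subset hf), hl.running h₄⟩ }
  · have ha := hS.actor _ _ hA
    refine hS.set ?_
    rw [Set.insert_eq_of_mem (Config.mem_dom_of_eq_some hA)]
    refine
      { proc_known := fun v hv => ?_
        state_known := ha.state_known
        queue_known := fun M hM => ha.queue_known M (List.mem_cons_of_mem _ hM)
        noUpd := (Proc.noUpd_subst _ _).2 (hr.2 d hd)
        newArity := (Proc.newArity_subst _ _ _).2 (hc.1.2 d hd)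
        root := fun h => ActorName.noConfusion h
        named := fun C' i' h => ?_ }
    · rw [Proc.fv_rename] at hv
      obtain ⟨x, -, rfl⟩ := Finset.mem_image.1 hv
      rw [Program.instSubst]
      split_ifs
      · exact ⟨ActorName.noConfusion, Config.mem_dom_of_eq_some hA⟩
      · cases hx : (d.params.zip Us).lookup x with
        | none => trivial
        | some U =>
          exact ha.queue_known ⟨d.name, Us⟩ List.mem_cons_self U (mem_of_lookup_zip hx).2
    · cases h
      refine ⟨(ha.named C i rfl).1, (Proc.noNew_subst _ _).2 (hb d hd), fun f hf => ?_,
        -- The residual is the whole body. The renaming has to be defined on actor names as well,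
        -- but none occurs in a source term.
        .inr ⟨d, hd, hC, _, fun v => match v with
          | .var x => p.instSubst S d (.named C i) Us x
          | .act B => .act B, .refl, ?_⟩⟩
      · rw [Proc.rename, Proc.fieldNames_subst] at hf
        exact hC ▸ hc.2 d hd f hf
      · rw [Proc.rename_rename]
        rfl

theorem Program.inv_init (hc : p.Correct) (hr : p.ReadOnly) : p.Inv p.init := by
  have hdom : p.init.dom = {.root} := by
    rw [Program.init, Config.dom_set]
    ext
    simp [Config.dom]
  have hfv : ∀ v ∈ (p.main.rename Value.var).fv, ∃ x ∈ p.main.fv, Value.var x = v := by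
    simp [Proc.fv_rename]
  refine ⟨hdom ▸ Set.finite_singleton _, hdom ▸ rfl, fun A a ha => ?_⟩
  obtain rfl : A = .root := by simpa [hdom] using Config.mem_dom_of_eq_some ha
  rw [Program.init, Config.set_self] at ha
  obtain rfl := Option.some.inj ha
  exact
    { proc_known := fun v hv => by
        obtain ⟨x, -, rfl⟩ := hfv v hv
        trivial
      state_known := fun f v h => by cases h
      queue_known := fun M hM => absurd hM List.not_mem_nil
      noUpd := (Proc.noUpd_subst _ _).2 hr.1
      newArity := (Proc.newArity_subst _ _ _).2 hc.1.1
      root := fun _ => ⟨rfl, rfl, fun v hv => by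
        obtain ⟨x, hx, rfl⟩ := hfv v hv
        exact hx⟩
      named := fun C i h => ActorName.noConfusion h }

theorem Program.Reachable.inv (hc : p.Correct) (hr : p.ReadOnly) (hb : p.BoundedActors)
    {S : Config} (h : p.Reachable S) : p.Inv S := by
  induction h with
  | refl => exact p.inv_init hc hr
  | tail _ h ih => exact ih.step hc hr hb h

end

/-! ### Skeletons -/

/-- The part of a term that determines the computation of the root actor. -/
def skeletonOf (A : ActorName) (a : ActorState) : ActorState :=
  ⟨if A = .root then a.proc else .nil, a.state, []⟩

/-- The process of the root actor and the states of all actors. -/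
def Config.skeleton (S : Config) : Config :=
  fun A => (S A).map (skeletonOf A)

theorem skeletonOf_skeletonOf (A : ActorName) (a : ActorState) :
    skeletonOf A (skeletonOf A a) = skeletonOf A a := by
  by_cases h : A = .root <;> simp [skeletonOf, h]

theorem Config.skeleton_skeleton (S : Config) : S.skeleton.skeleton = S.skeleton := by
  funext A
  simp [Config.skeleton, Option.map_map, Function.comp_def, skeletonOf_skeletonOf]

theorem Config.dom_skeleton (S : Config) : S.skeleton.dom = S.dom := by
  ext A
  simp [Config.dom, Config.skeleton]

theorem Config.skeleton_deliver (S : Config) (o : Option (ActorName × Message)) :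
    (S.deliver o).skeleton = S.skeleton := by
  funext A
  simp only [Config.skeleton, Config.deliver, Option.map_map]
  rfl

theorem Config.skeleton_set (S : Config) (A : ActorName) (a : ActorState) :
    (S.set A a).skeleton = S.skeleton.set A (skeletonOf A a) := by
  funext B
  rcases eq_or_ne B A with rfl | hB
  · rw [Config.set_self, Config.skeleton, Config.set_self, Option.map_some]
  · rw [Config.set_of_ne _ hB, Config.skeleton, Config.set_of_ne _ hB, Config.skeleton]

theorem Config.set_eq_self {S : Config} {A : ActorName} {a : ActorState} (h : S A = some a) :
    S.set A a = S := by
  rw [Config.set, ← h, Function.update_eq_self]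

/-- Taking skeletons thus becomes an instance of `Config.Rel`, to which `LocalStep.transport`
applies. -/
theorem Config.rel_skeleton_iff {S S' : Config} :
    Config.Rel (fun A a a' => a' = skeletonOf A a) S S' ↔ S' = S.skeleton := by
  refine ⟨fun h => ?_, ?_⟩
  · funext A
    have := h A
    rw [Config.skeleton]
    generalize S A = o at this ⊢
    generalize S' A = o' at this ⊢
    cases this with
    | some h => rw [h, Option.map_some]
    | none => rfl
  · rintro rfl A
    rw [Config.skeleton]
    cases S A with
    | none => exact .none
    | some a => exact .some rfl

/-- The size of the process of the root actor. -/
def Config.rootSize (S : Config) : ℕ := (S .root).elim 0 fun a => a.proc.size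

/-- Steps of skeletons. -/
def Program.SkeletonStep (p : Program) (s t : Config) : Prop :=
  (∃ u, p.Step s u ∧ t = u.skeleton) ∧ t.dom.Finite ∧ t.rootSize < s.rootSize

/-- Actors other than the root neither create actors nor change states, so their steps are invisible
in the skeleton. A step of the root depends only on its process, its state and the names in use, all
of which the skeleton retains. -/
theorem Program.Inv.skeletonStep {p : Program} {S S' : Config} (hS : p.Inv S) (hS' : p.Inv S')
    (h : p.Step S S') : S'.skeleton = S.skeleton ∨ p.SkeletonStep S.skeleton S'.skeleton := by
  rcases (p.step_iff S S').1 h with ⟨A, P, φ, q, P', φ', o, T, hA, hl, rfl⟩ |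
    ⟨C, i, d, φ, q, Us, hA, hd, hC, hU, rfl⟩
  · have ha := hS.actor A _ hA
    cases A with
    | root =>
      right
      obtain ⟨T', hT', hTT'⟩ := hl.transport (R := fun A a a' => a' = skeletonOf A a)
        (fun C i φ => rfl) (Config.rel_skeleton_iff.2 rfl)
      obtain rfl := Config.rel_skeleton_iff.1 hTT'
      have hroot : S.skeleton .root = some ⟨P, φ, []⟩ := by
        rw [Config.skeleton, hA]
        rfl
      refine ⟨⟨_, (p.step_iff _ _).2 (.inl ⟨.root, P, φ, [], P', φ', o, _, hroot, hT', rfl⟩), ?_⟩,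
        ?_, ?_⟩
      · rw [Config.skeleton_deliver, Config.skeleton_deliver, Config.skeleton_set,
          Config.skeleton_set, Config.skeleton_skeleton]
        rfl
      · rw [Config.dom_skeleton]
        exact hS'.finite_dom
      · rw [Config.skeleton_deliver, Config.skeleton_set, Config.rootSize, Config.rootSize,
          Config.set_self, hroot]
        exact hl.size_lt
    | named C i =>
      left
      obtain rfl := hl.eq_of_noNew (ha.named C i rfl).2.1
      obtain rfl := hl.state_eq ha.noUpd
      rw [Config.skeleton_deliver, Config.skeleton_set]
      refine Config.set_eq_self ?_
      rw [Config.skeleton, hA]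
      rfl
  · left
    rw [Config.skeleton_set]
    refine Config.set_eq_self ?_
    rw [Config.skeleton, hA]
    rfl

/-- Skeleton steps are finitely branching and decrease the size of the root process, so they reach
finitely many skeletons. -/
theorem Program.finite_skeletons {p : Program} (hc : p.Correct) (hr : p.ReadOnly)
    (hb : p.BoundedActors) : {s | ∃ S, p.Reachable S ∧ S.skeleton = s}.Finite := by
  have hfin := finite_reflTransGen (r := p.SkeletonStep) Config.rootSize (fun _ _ h => h.2.2)
    (good := {s | s.dom.Finite}) (fun _ _ _ h => h.2.1)
    (fun s hs => ((p.finite_step hs).image Config.skeleton).subset fun t ⟨⟨u, hu, ht⟩, _⟩ =>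
      ⟨u, hu, ht.symm⟩) p.init.skeleton
    (by
      rw [Set.mem_ofPred_eq, Config.dom_skeleton]
      exact (p.inv_init hc hr).finite_dom)
  refine hfin.subset ?_
  rintro _ ⟨S, hS, rfl⟩
  induction hS with
  | refl => exact .refl
  | @tail S S' hS h ih =>
    have hS' := Program.Reachable.inv hc hr hb hS
    rcases hS'.skeletonStep (hS'.step hc hr hb h) h with h | h
    · rw [h]
      exact ih
    · exact .tail ih h

/-! ### The ordering is a well-quasi-ordering -/

/-- The process of an actor. -/
def Config.procOf (S : Config) (A : ActorName) : Proc Value 0 := (S A).elim .nil ActorState.proc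

/-- The queue of an actor. -/
def Config.queueOf (S : Config) (A : ActorName) : List Message := (S A).elim [] ActorState.queue

/-- Equal skeletons already account for the actor names and the states. -/
theorem Program.configLE_of_skeleton_eq {p : Program} {S S' : Config}
    (hs : S.skeleton = S'.skeleton)
    (h : ∀ A ∈ S.dom, p.ProcEquiv (S.procOf A) (S'.procOf A) ∧
      p.QueueLE (S.queueOf A) (S'.queueOf A)) : p.ConfigLE S S' := by
  intro A
  have hA := congrFun hs A
  have h' := h A
  simp only [Config.skeleton, Config.procOf, Config.queueOf, Config.dom] at hA h'
  cases hSA : S A with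
  | none => cases hSA' : S' A with
    | none => exact .none
    | some a' => simp [hSA, hSA'] at hA
  | some a => cases hSA' : S' A with
    | none => simp [hSA, hSA'] at hA
    | some a' =>
      have h' := h' (by simp [hSA])
      rw [hSA, hSA'] at hA h'
      have := congrArg ActorState.state (Option.some.inj hA)
      exact .some ⟨h'.1, this, h'.2⟩

theorem Program.wellQuasiOrdered {p : Program} (hc : p.Correct) (hr : p.ReadOnly)
    (hb : p.BoundedActors) (ht : p.TypeSafe) (s : ℕ → p.State) :
    ∃ i j, i < j ∧ p.LE (s i) (s j) := by
  have hK := Program.finite_skeletons hc hr hb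
  set K := {s | ∃ S, p.Reachable S ∧ S.skeleton = s} with hKdef
  have hinv (n) : p.Inv (s n).1 := Program.Reachable.inv hc hr hb (s n).2
  have hsK (n) : (s n).1.skeleton ∈ K := ⟨_, (s n).2, rfl⟩
  have hD : (⋃ t ∈ K, t.dom).Finite := hK.biUnion fun t ⟨S, hS, h⟩ => by
    rw [← h, Config.dom_skeleton]
    exact (Program.Reachable.inv hc hr hb hS).finite_dom
  have hsD (n) {A} (hA : A ∈ (s n).1.dom) : A ∈ ⋃ t ∈ K, t.dom :=
    Set.mem_biUnion (hsK n) (by rwa [Config.dom_skeleton])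
  set D := ⋃ t ∈ K, t.dom
  have : Finite D := hD
  -- `R` contains every known rigid value of the configurations in the sequence.
  let R : Finset Value := p.main.fv.image Value.var ∪ hD.toFinset.image Value.act
  have hR (n) {v} (hv : KnownIn (s n).1.dom v) (hv' : p.Rigid v) : v ∈ R := by
    cases v with
    | var x => exact Finset.mem_union_left _ (Finset.mem_image_of_mem _ hv')
    | act B =>
      exact Finset.mem_union_right _ (Finset.mem_image_of_mem _ (hD.mem_toFinset.2 (hsD n hv.2)))
  -- The root contributes finitely many processes, the methods finitely many residuals up to
  -- renaming. The process `.nil` is that of an idle actor and also the default of `procOf` for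
  -- absent actors.
  let procs : Set (Proc Value 0) := insert .nil ((fun t : Config => t.procOf .root) '' K) ∪
    ⋃ d ∈ p.defs, ⋃ Q ∈ (d.body.rename Value.var).finite_residuals.toFinset,
      {P | ∃ σ : Value → Value, P = Q.rename σ ∧ ∀ v ∈ P.fv, p.Rigid v → v ∈ R}
  have hprocs : procs.PartiallyWellOrderedOn p.ProcEquiv := by
    refine ((hK.image _).insert _).partiallyWellOrderedOn.union ?_
    rw [Finset.partiallyWellOrderedOn_bUnion]
    intro d _
    rw [Finset.partiallyWellOrderedOn_bUnion]
    exact fun Q _ => p.partiallyWellOrderedOn_rename R Q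
  let msgs : Set Message := ⋃ d ∈ p.defs,
    {M | M.name = d.name ∧ M.args.length = d.params.length ∧ ∀ v ∈ M.args, p.Rigid v → v ∈ R}
  have hmsgs : msgs.PartiallyWellOrderedOn p.MsgEquiv := by
    rw [Finset.partiallyWellOrderedOn_bUnion]
    exact fun d _ => p.partiallyWellOrderedOn_messages R _ _
  -- Higman's lemma.
  have hqueues : {q : List Message | ∀ M ∈ q, M ∈ msgs}.PartiallyWellOrderedOn p.QueueLE :=
    hmsgs.partiallyWellOrderedOn_sublistForall₂ _
  have : IsPreorder (Proc Value 0 × List Message)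
      fun x y => p.ProcEquiv x.1 y.1 ∧ p.QueueLE x.2 y.2 :=
    { refl := fun x => ⟨refl_of p.ProcEquiv x.1, refl_of p.QueueLE x.2⟩
      trans := fun x y z h h' =>
        ⟨trans_of p.ProcEquiv h.1 h'.1, trans_of p.QueueLE h.2 h'.2⟩ }
  have hmem (n A) : ((s n).1.procOf A, (s n).1.queueOf A) ∈
      procs ×ˢ {q : List Message | ∀ M ∈ q, M ∈ msgs} := by
    simp only [Set.mem_prod, Config.procOf, Config.queueOf]
    cases hSA : (s n).1 A with
    | none => exact ⟨.inl (.inl rfl), fun M hM => absurd hM List.not_mem_nil⟩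
    | some a =>
      have ha := (hinv n).actor A a hSA
      cases A with
      | root =>
        refine ⟨.inl (.inr ⟨_, hsK n, ?_⟩), ?_⟩
        · simp [Config.procOf, Config.skeleton, hSA, skeletonOf]
        · simp [(ha.root rfl).1]
      | named C i =>
        refine ⟨?_, fun M hM => ?_⟩
        · rcases (ha.named C i rfl).2.2.2 with h | ⟨d, hd, -, Q, σ, hQ, h⟩
          · exact .inl (.inl h)
          · refine .inr (Set.mem_biUnion hd (Set.mem_biUnion ?_
              ⟨σ, h, fun v hv => hR n (ha.proc_known v hv)⟩))
            exact (Set.Finite.mem_toFinset _).2 hQ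
        · obtain ⟨d, hd, -, hm, hl⟩ := (ht _ (s n).2 C i a hSA).2 M hM
          exact Set.mem_biUnion hd ⟨hm.symm, hl.symm, fun v hv => hR n (ha.queue_known M hM v hv)⟩
  -- Skeletons are compared by equality, which is a well-quasi-ordering on a finite set; the rest is
  -- a product over the finitely many actors in `D`.
  have hall := (Set.Finite.partiallyWellOrderedOn (r := Eq) hK).prod
    (Set.PartiallyWellOrderedOn.pi (ι := D) fun _ => hprocs.prod hqueues)
  obtain ⟨i, j, hij, hsk, h⟩ := hall.exists_lt
    (f := fun n => ((s n).1.skeleton, fun A : D => ((s n).1.procOf A, (s n).1.queueOf A)))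
    fun n => ⟨hsK n, fun A _ => hmem n A⟩
  exact ⟨i, j, hij, Program.configLE_of_skeleton_eq hsk fun A hA => h ⟨A, hsD i hA⟩⟩

/-! ### Queues -/

section
variable {p : Program}

theorem Program.QueueLE.append_right {q q' : List Message} (h : p.QueueLE q q')
    (r : List Message) : p.QueueLE q (q' ++ r) := by
  induction h with
  | nil => exact .nil
  | cons h _ ih => exact .cons h ih
  | cons_right _ ih => exact .cons_right ih

theorem Program.QueueLE.append {q q' r r' : List Message} (h : p.QueueLE q q')
    (hr : p.QueueLE r r') : p.QueueLE (q ++ r) (q' ++ r') := by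
  induction h with
  | @nil l =>
    induction l with
    | nil => exact hr
    | cons _ _ ih => exact .cons_right ih
  | cons h _ ih => exact .cons h ih
  | cons_right _ ih => exact .cons_right ih

theorem Program.QueueLE.exists_of_cons {M : Message} {q q' : List Message}
    (h : p.QueueLE (M :: q) q') :
    ∃ pre M' q'', q' = pre ++ M' :: q'' ∧ p.MsgEquiv M M' ∧ p.QueueLE q q'' := by
  induction q' with
  | nil => cases h
  | cons N q' ih =>
    cases h with
    | cons h h' => exact ⟨[], N, q', rfl, h, h'⟩
    | cons_right h =>
      obtain ⟨pre, M', q'', rfl, h, h'⟩ := ih h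
      exact ⟨N :: pre, M', q'', rfl, h, h'⟩

theorem Program.queueLE_mailFor {θ : Equiv.Perm Value} (hθ : p.IsAut θ)
    (o : Option (ActorName × Message)) (A : ActorName) :
    p.QueueLE (mailFor o A)
      (mailFor (o.map fun m => (m.1, ⟨m.2.name, m.2.args.map θ⟩)) A) := by
  rcases o with _ | ⟨B, M⟩
  · exact .nil
  · simp only [mailFor, Option.map_some]
    split_ifs
    · exact .cons ((p.msgEquiv_iff _ _).2 ⟨θ, hθ, rfl⟩) .nil
    · exact .nil

-- The ordering of configurations

theorem Program.ConfigLE.deliver {S S' : Config} (h : p.ConfigLE S S') {θ : Equiv.Perm Value}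
    (hθ : p.IsAut θ) (o : Option (ActorName × Message)) :
    p.ConfigLE (S.deliver o)
      (S'.deliver (o.map fun m => (m.1, ⟨m.2.name, m.2.args.map θ⟩))) := by
  intro A
  have := h A
  simp only [Config.deliver]
  generalize S A = x at this ⊢
  generalize S' A = y at this ⊢
  cases this with
  | none => exact .none
  | some h => exact .some ⟨h.1, h.2.1, h.2.2.append (p.queueLE_mailFor hθ o A)⟩

theorem Program.ConfigLE.refl (p : Program) (S : Config) : p.ConfigLE S S := by
  intro A
  cases S A with
  | none => exact .none
  | some a => exact .some ⟨refl_of p.ProcEquiv _, rfl, refl_of p.QueueLE _⟩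

theorem Program.ConfigLE.trans {S S' S'' : Config} (h : p.ConfigLE S S') (h' : p.ConfigLE S' S'') :
    p.ConfigLE S S'' := by
  intro A
  have h₁ := h A
  have h₂ := h' A
  generalize S A = x at h₁ ⊢
  generalize S' A = y at h₁ h₂
  generalize S'' A = z at h₂ ⊢
  cases h₁ with
  | none => exact h₂
  | some h₁ => cases h₂ with
    | some h₂ =>
      exact .some ⟨trans_of p.ProcEquiv h₁.1 h₂.1, h₁.2.1.trans h₂.2.1,
        trans_of p.QueueLE h₁.2.2 h₂.2.2⟩

/-! ### Instantiation of method bodies -/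

theorem Program.finite_uses (p : Program) : {x | p.Uses x}.Finite := by
  refine ({this} ∪ (p.main.fv ∪ p.defs.biUnion fun d => d.params.toFinset ∪ d.body.fv) :
    Finset Var).finite_toSet.subset fun x hx => ?_
  simpa [Program.Uses] using hx

theorem Program.Inv.finite_uses {S : Config} (hS : p.Inv S) : {x | S.Uses x}.Finite := by
  have hs (A : ActorName) : {a | S A = some a}.Finite :=
    Set.Subsingleton.finite fun a ha b hb => Option.some.inj (ha.symm.trans hb)
  have hinj : Function.Injective Value.var := fun _ _ h => Value.var.inj h
  have hfin : (⋃ A ∈ S.dom, ⋃ a ∈ {a | S A = some a}, Value.var ⁻¹'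
      (a.proc.fv ∪ (a.queue.flatMap Message.args).toFinset : Finset Value)).Finite :=
    hS.finite_dom.biUnion fun A _ => (hs A).biUnion fun a _ =>
      (Finset.finite_toSet _).preimage hinj.injOn
  -- Variables stored in fields are rigid, hence free in the main process; the states need not have
  -- finite support for this bound.
  refine (hfin.union p.main.fv.finite_toSet).subset ?_
  rintro x ⟨A, a, hA, h⟩
  rcases h with h | ⟨f, h⟩ | ⟨M, hM, h⟩
  · exact .inl (Set.mem_biUnion (Config.mem_dom_of_eq_some hA) (Set.mem_biUnion hA (by simp [h])))
  · exact .inr ((hS.actor A a hA).state_known f _ h).2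
  · refine .inl (Set.mem_biUnion (Config.mem_dom_of_eq_some hA) (Set.mem_biUnion hA ?_))
    simp only [Finset.coe_union, Set.mem_preimage, Set.mem_union]
    exact .inr (by simpa using ⟨M, hM, h⟩)

theorem Program.Inv.infinite_unused {S : Config} (hS : p.Inv S) :
    (Set.ofPred fun x => ¬ S.Uses x ∧ ¬ p.Uses x).Infinite := by
  refine ((hS.finite_uses.union p.finite_uses).infinite_compl).mono fun x hx => ?_
  exact ⟨fun h => hx (.inl h), fun h => hx (.inr h)⟩

theorem Program.Inv.freshVar_spec {S : Config} (hS : p.Inv S) (k : ℕ) :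
    ¬ S.Uses (p.freshVar S k) ∧ ¬ p.Uses (p.freshVar S k) :=
  Nat.nth_mem_of_infinite hS.infinite_unused k

theorem Program.Inv.freshVar_injective {S : Config} (hS : p.Inv S) :
    Function.Injective (p.freshVar S) :=
  Nat.nth_injective hS.infinite_unused

/-- The values put in by the instantiation of a method body: actual values for `this` and the formal
parameters, fresh variables for the others. -/
theorem Program.instSubst_cases (p : Program) (d : MethodDef) (A : ActorName) {Us : List Value}
    (hl : Us.length = d.params.length) {x : Var} (hx : x ∈ d.body.fv) :
    (∃ U, (U = .act A ∨ U ∈ Us) ∧ ∀ S (θ : Equiv.Perm Value), θ (.act A) = .act A →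
      p.instSubst S d A (Us.map θ) x = θ U) ∨
    (x ∈ d.localVars ∧ ∀ S (θ : Equiv.Perm Value), p.instSubst S d A (Us.map θ) x =
      .var (p.freshVar S (Nat.count (fun y => y ∈ d.localVars) x))) := by
  by_cases h0 : x = this
  · refine .inl ⟨.act A, .inl rfl, fun S θ hθ => ?_⟩
    rw [Program.instSubst, if_pos h0, hθ]
  by_cases hp : x ∈ d.params
  · obtain ⟨U, hU⟩ := exists_lookup_zip hl hp
    refine .inl ⟨U, .inr (mem_of_lookup_zip hU).2, fun S θ _ => ?_⟩
    rw [Program.instSubst, if_neg h0, lookup_zip_map, hU]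
    rfl
  · refine .inr ⟨by simp [MethodDef.localVars, hx, hp, h0], fun S θ => ?_⟩
    rw [Program.instSubst, if_neg h0]
    cases h : (d.params.zip (Us.map θ)).lookup x with
    | none => rfl
    | some U => exact absurd (mem_of_lookup_zip h).1 hp

/-- Both instances are families of values indexed by the free names of the body. Actual values
correspond under `θ`, fresh variables by their position. Fresh variables are non-rigid and, the
arguments being in use in the respective configuration, different from all actual values. So
partitions and rigid members agree, and `Program.exists_isAut` applies. -/
theorem Program.procEquiv_inst {S S' : Config} (hS : p.Inv S) (hS' : p.Inv S') (d : MethodDef)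
    (A : ActorName) {Us : List Value} (hl : Us.length = d.params.length) {θ : Equiv.Perm Value}
    (hθ : p.IsAut θ) (hu : ∀ x, Value.var x ∈ Us → S.Uses x)
    (hu' : ∀ x, Value.var x ∈ Us.map θ → S'.Uses x) :
    p.ProcEquiv (d.body.rename (p.instSubst S d A Us))
      (d.body.rename (p.instSubst S' d A (Us.map θ))) := by
  let f (x : d.body.fv) := p.instSubst S d A Us x
  let g (x : d.body.fv) := p.instSubst S' d A (Us.map θ) x
  have hact (η : Equiv.Perm Value) (h : p.IsAut η) : η (.act A) = .act A := h _ trivial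
  have hUs : Us.map (1 : Equiv.Perm Value) = Us := by simp
  have key (x : d.body.fv) : (∃ U, (U = .act A ∨ U ∈ Us) ∧ f x = U ∧ g x = θ U) ∨
      (x.1 ∈ d.localVars ∧ f x = .var (p.freshVar S (Nat.count (fun y => y ∈ d.localVars) x)) ∧
        g x = .var (p.freshVar S' (Nat.count (fun y => y ∈ d.localVars) x))) := by
    rcases p.instSubst_cases d A hl x.2 with ⟨U, hU, h⟩ | ⟨hx, h⟩
    · have h₁ := h S 1 rfl
      rw [hUs] at h₁
      exact .inl ⟨U, hU, h₁, h S' θ (hact θ hθ)⟩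
    · have h₁ := h S 1
      rw [hUs] at h₁
      exact .inr ⟨hx, h₁, h S' θ⟩
  have hf {U} (hU : U = .act A ∨ U ∈ Us) (k) : U ≠ .var (p.freshVar S k) := by
    rintro rfl
    exact (hS.freshVar_spec k).1 (hu _ (hU.resolve_left Value.noConfusion))
  have hg {U} (hU : U = .act A ∨ U ∈ Us) (k) : θ U ≠ .var (p.freshVar S' k) := by
    intro h
    refine (hS'.freshVar_spec k).1 (hu' _ (h ▸ List.mem_map_of_mem (hU.resolve_left ?_)))
    rintro rfl
    rw [hact θ hθ] at h
    cases h
  have hnr {T : Config} (hT : p.Inv T) (k) : ¬ p.Rigid (.var (p.freshVar T k)) := fun h =>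
    (hT.freshVar_spec k).2 (.inr (.inl h))
  have hfg (x y) : f x = f y ↔ g x = g y := by
    rcases key x with ⟨U, hU, hfx, hgx⟩ | ⟨hx, hfx, hgx⟩ <;>
      rcases key y with ⟨V, hV, hfy, hgy⟩ | ⟨hy, hfy, hgy⟩ <;> rw [hfx, hgx, hfy, hgy]
    · exact (EmbeddingLike.apply_eq_iff_eq θ).symm
    · exact iff_of_false (hf hU _) (hg hU _)
    · exact iff_of_false (hf hV _).symm (hg hV _).symm
    -- Both sides become the same equation between positions.
    · rw [Value.var.injEq, Value.var.injEq, hS.freshVar_injective.eq_iff,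
        hS'.freshVar_injective.eq_iff]
  have hrig (x) (hx : p.Rigid (f x) ∨ p.Rigid (g x)) : f x = g x := by
    rcases key x with ⟨U, hU, hfx, hgx⟩ | ⟨-, hfx, hgx⟩
    · rw [hfx, hgx, hθ.rigid_iff, or_self] at hx
      rw [hfx, hgx, hθ U hx]
    · rw [hfx, hgx] at hx
      exact (hx.elim (hnr hS _) (hnr hS' _)).elim
  obtain ⟨η, hη, h⟩ := p.exists_isAut f g hfg hrig
  refine (p.procEquiv_iff _ _).2 ⟨η, hη, ?_⟩
  rw [Proc.rename_rename]
  exact d.body.rename_congr fun x hx => (h ⟨x, hx⟩).symm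

/-! ### Progress of the methods -/

theorem Eval.exists_of_noNew (fields : ClassName → List FieldName) {φ : FieldState} (S : Config)
    {E : Expr Value 0} (hE : E.NoNew) (hφ : ∀ f ∈ E.fieldNames, ∃ v, φ f = some v) :
    ∃ U, Eval fields φ S E U S := by
  cases E with
  | field f =>
    obtain ⟨U, hU⟩ := hφ f (Finset.mem_singleton_self f)
    exact ⟨U, .field S f U hU⟩
  | name x =>
    cases x with
    | bound i => exact i.elim0
    | free U => exact ⟨U, .value S U⟩
  | new => exact hE.elim

theorem EvalList.exists_of_noNew (fields : ClassName → List FieldName) {φ : FieldState}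
    (S : Config) {Es : List (Expr Value 0)} (hE : ∀ E ∈ Es, E.NoNew)
    (hφ : ∀ f ∈ Expr.fieldNamesList Es, ∃ v, φ f = some v) :
    ∃ Us, EvalList fields φ S Es Us S := by
  induction Es with
  | nil => exact ⟨[], .nil S⟩
  | cons E Es ih =>
    simp only [Expr.fieldNamesList, Finset.mem_union] at hφ
    obtain ⟨U, hU⟩ := Eval.exists_of_noNew fields S (hE E List.mem_cons_self)
      fun f hf => hφ f (.inl hf)
    obtain ⟨Us, hUs⟩ := ih (fun E' hE' => hE E' (List.mem_cons_of_mem _ hE'))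
      fun f hf => hφ f (.inr hf)
    exact ⟨U :: Us, .cons _ _ _ _ _ _ _ hU hUs⟩

/-- Without creations and updates, a process other than `.nil` can be stuck only on an undefined
field or on a target that is not a present actor. -/
theorem LocalStep.exists (fields : ClassName → List FieldName) {φ : FieldState} (S : Config)
    {P : Proc Value 0} (hne : P ≠ .nil) (hn : P.NoNew) (hu : P.NoUpd)
    (hφ : ∀ f ∈ P.fieldNames, ∃ v, φ f = some v)
    (hs : ∀ U m Es Q, P = .send (.free U) m Es Q → ∃ B ∈ S.dom, U = .act B) :
    ∃ P' o, LocalStep fields φ S P P' φ o S := by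
  cases P with
  | nil => exact absurd rfl hne
  | upd => exact hu.elim
  | letIn E P =>
    simp only [Proc.fieldNames, Finset.mem_union] at hφ
    obtain ⟨U, hU⟩ := Eval.exists_of_noNew fields S hn.1 fun f hf => hφ f (.inl hf)
    exact ⟨_, _, .letIn hU⟩
  | send x m Es P =>
    simp only [Proc.fieldNames, Finset.mem_union] at hφ
    cases x with
    | bound i => exact i.elim0
    | free V =>
      obtain ⟨B, hB, rfl⟩ := hs _ _ _ _ rfl
      obtain ⟨Us, hUs⟩ := EvalList.exists_of_noNew fields S hn.1 fun f hf => hφ f (.inl hf)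
      exact ⟨_, _, .send hB hUs⟩
  | cond E E' P Q =>
    simp only [Proc.fieldNames, Finset.mem_union] at hφ
    obtain ⟨U, hU⟩ := Eval.exists_of_noNew fields S hn.1 fun f hf => hφ f (.inl (.inl (.inl hf)))
    obtain ⟨V, hV⟩ := Eval.exists_of_noNew fields S hn.2.1
      fun f hf => hφ f (.inl (.inl (.inr hf)))
    have hUV : EvalList fields φ S [E, E'] [U, V] S :=
      .cons _ _ _ _ _ _ _ hU (.cons _ _ _ _ _ _ _ hV (.nil _))
    by_cases h : U = V
    · subst h
      exact ⟨_, _, .matched hUV⟩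
    · exact ⟨_, _, .mismatched hUV h⟩
  | plus P Q => exact ⟨_, _, .plusL⟩

/-- The terms of the actors other than `A` are the same up to additional messages. -/
def Config.GrowsOff (A : ActorName) (S S' : Config) : Prop :=
  ∀ B ≠ A, ∃ r : List Message, S' B = (S B).map fun b => ⟨b.proc, b.state, b.queue ++ r⟩

theorem Config.GrowsOff.refl (A : ActorName) (S : Config) : Config.GrowsOff A S S :=
  fun B _ => ⟨[], by simp⟩

theorem Config.GrowsOff.trans {A : ActorName} {S S' S'' : Config} (h : Config.GrowsOff A S S')
    (h' : Config.GrowsOff A S' S'') : Config.GrowsOff A S S'' := by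
  intro B hB
  obtain ⟨r, hr⟩ := h B hB
  obtain ⟨r', hr'⟩ := h' B hB
  exact ⟨r ++ r', by simp [hr', hr, Option.map_map, Function.comp_def]⟩

theorem Config.growsOff_set_deliver (S : Config) (A : ActorName) (a : ActorState)
    (o : Option (ActorName × Message)) : Config.GrowsOff A S ((S.set A a).deliver o) :=
  fun B hB => ⟨mailFor o B, by rw [Config.deliver, Config.set_of_ne _ hB]⟩

/-- An actor can complete the method that it executes. -/
theorem Program.exists_completion (hc : p.Correct) (hr : p.ReadOnly) (hb : p.BoundedActors)
    (ht : p.TypeSafe) {C : ClassName} {i : ℕ} {φ : FieldState} {P : Proc Value 0} {S : Config}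
    {q : List Message} (hS : p.Reachable S) (hA : S (.named C i) = some ⟨P, φ, q⟩) :
    ∃ S' r, Relation.ReflTransGen p.Step S S' ∧ S' (.named C i) = some ⟨.nil, φ, q ++ r⟩ ∧
      Config.GrowsOff (.named C i) S S' := by
  induction hn : P.size using Nat.strong_induction_on generalizing P S q with
  | _ n ih =>
    by_cases hne : P = .nil
    · subst hne
      exact ⟨S, [], .refl, by simpa using hA, .refl _ _⟩
    have ha := (hS.inv hc hr hb).actor _ _ hA
    obtain ⟨h₁, h₂, h₃, -⟩ := ha.named C i rfl
    obtain ⟨P', o, hl⟩ := LocalStep.exists p.fields S hne h₂ ha.noUpd (fun f hf => h₁ f (h₃ f hf))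
      fun U m Es Q hP => by
        subst hP
        obtain ⟨B, rfl⟩ := (ht S hS C i _ hA).1 U m Es Q rfl
        exact ⟨B, (ha.proc_known (.act B) (by simp [Proc.fv, Name.fv])).2, rfl⟩
    have hstep := (p.step_iff _ _).2 (.inl ⟨_, P, φ, q, P', φ, o, S, hA, hl, rfl⟩)
    -- The size of the process decreases. Messages that the actor sends to itself accumulate at the
    -- end of its queue.
    obtain ⟨S', r, hS', hA', hg⟩ := ih P'.size (hn ▸ hl.size_lt) (hS.tail hstep)
      (Config.deliver_eq_some (Config.set_self ..)) rfl
    exact ⟨S', mailFor o (.named C i) ++ r, .head hstep hS', by simpa using hA',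
      Config.GrowsOff.trans (Config.growsOff_set_deliver _ _ _ _) hg⟩

/-- An actor can process the first messages of its queue. -/
theorem Program.exists_consumption (hc : p.Correct) (hr : p.ReadOnly) (hb : p.BoundedActors)
    (ht : p.TypeSafe) {C : ClassName} {i : ℕ} {φ : FieldState} (pre : List Message) {S : Config}
    {q : List Message} (hS : p.Reachable S) (hA : S (.named C i) = some ⟨.nil, φ, pre ++ q⟩) :
    ∃ S' r, Relation.ReflTransGen p.Step S S' ∧ S' (.named C i) = some ⟨.nil, φ, q ++ r⟩ ∧
      Config.GrowsOff (.named C i) S S' := by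
  induction pre generalizing S q with
  | nil => exact ⟨S, [], .refl, by simpa using hA, .refl _ _⟩
  | cons M pre ih =>
    -- Type safety provides a method for the head of the queue. Its execution may add messages, but
    -- only behind `q`, so the prefix to be consumed gets shorter.
    obtain ⟨d, hd, hC, hm, hl⟩ := (ht S hS C i _ hA).2 M List.mem_cons_self
    obtain ⟨m, Us⟩ := M
    obtain rfl : d.name = m := hm
    have hstep := Program.Step.inst (p := p) S C i d φ (pre ++ q) Us hA hd hC hl.symm
    obtain ⟨S₁, r₁, hS₁, hA₁, hg₁⟩ := Program.exists_completion hc hr hb ht (hS.tail hstep)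
      (Config.set_self ..)
    rw [List.append_assoc] at hA₁
    obtain ⟨S₂, r₂, hS₂, hA₂, hg₂⟩ := ih ((hS.tail hstep).trans hS₁) hA₁
    have hg := Config.growsOff_set_deliver S (.named C i)
      ⟨d.body.rename (p.instSubst S d (.named C i) Us), φ, pre ++ q⟩ none
    rw [Config.deliver_none] at hg
    exact ⟨S₂, r₁ ++ r₂, .head hstep (hS₁.trans hS₂), by simpa using hA₂, (hg.trans hg₁).trans hg₂⟩

/-! ### Upward compatibility -/

/-- One step is answered by one step. Code without `new` commutes with the permutation relating the
two processes; a process with rigid names only is left unchanged by it, so its step is repeated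
literally and creates actors with the same names. -/
theorem Program.exists_localStep_of_configLE {S S' T : Config} (hS : p.Inv S)
    (hle : p.ConfigLE S S') {A : ActorName} {P P' : Proc Value 0} {φ φ' : FieldState}
    {q : List Message} {o : Option (ActorName × Message)} (hA : S A = some ⟨P, φ, q⟩)
    (hl : LocalStep p.fields φ S P P' φ' o T) :
    ∃ S₂, p.Step S' S₂ ∧ p.ConfigLE ((T.set A ⟨P', φ', q⟩).deliver o) S₂ := by
  have hle' : Config.Rel (fun _ a a' => p.ProcEquiv a.proc a'.proc ∧ a.state = a'.state ∧
    p.QueueLE a.queue a'.queue) S S' := hle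
  obtain ⟨⟨Q, ψ, q'⟩, hA', hPQ, rfl, hq⟩ := hle'.exists_of_eq_some hA
  have ha := hS.actor A _ hA
  obtain ⟨θ, hθ, T', hl', hTT'⟩ : ∃ θ : Equiv.Perm Value, p.IsAut θ ∧ ∃ T',
      LocalStep p.fields φ S' Q (P'.rename θ) φ'
        (o.map fun m => (m.1, ⟨m.2.name, m.2.args.map θ⟩)) T' ∧ p.ConfigLE T T' := by
    obtain ⟨θ, hθ, h : Q = P.rename θ⟩ := (p.procEquiv_iff _ _).1 hPQ
    rcases ha.noNew_or_rigid with hn | hrig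
    -- The state holds rigid values, which `θ` fixes, so fields evaluate to the same values on both
    -- sides.
    · obtain rfl := hl.eq_of_noNew hn
      refine ⟨θ, hθ, S', h ▸ hl.rename hn ha.noUpd θ.injective (fun B => hθ _ trivial)
        (fun f v hv => hθ v (ha.state_known f v hv).2) fun B hB => (hle'.mem_dom_iff B).1 hB, hle⟩
    · have hQ : Q = P := by
        rw [h]
        exact (P.rename_congr fun v hv => hθ v (hrig v hv)).trans P.rename_id
      obtain ⟨T', hl', hTT'⟩ := hl.transport
        (fun C i φ => ⟨refl_of p.ProcEquiv _, rfl, refl_of p.QueueLE _⟩) hle'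
      -- Since the two processes coincide, `θ` is discarded in favour of the identity.
      refine ⟨1, .one p, T', ?_, hTT'⟩
      rw [hQ, Equiv.Perm.coe_one, Proc.rename_id]
      simpa using hl'
  refine ⟨_, (p.step_iff _ _).2 (.inl ⟨A, Q, φ, q', _, φ', _, T', hA', hl', rfl⟩), ?_⟩
  refine Program.ConfigLE.deliver ?_ hθ o
  exact Config.Rel.set (R := fun _ a a' => p.ProcEquiv a.proc a'.proc ∧ a.state = a'.state ∧
    p.QueueLE a.queue a'.queue) hTT' ⟨(p.procEquiv_iff _ _).2 ⟨θ, hθ, rfl⟩, rfl, hq⟩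

/-- Only instantiation may need more than one step in answer: the messages in front of the matching
one have to be processed first. This affects the other actors merely by lengthening their queues,
which the ordering tolerates. -/
theorem Program.upward_compatible (hc : p.Correct) (hr : p.ReadOnly) (hb : p.BoundedActors)
    (ht : p.TypeSafe) {S S' S₂ : Config} (hS : p.Reachable S) (hS' : p.Reachable S')
    (hle : p.ConfigLE S S') (h : p.Step S S₂) :
    ∃ S₂', Relation.ReflTransGen p.Step S' S₂' ∧ p.ConfigLE S₂ S₂' := by
  have hinv := hS.inv hc hr hb
  rcases (p.step_iff S S₂).1 h with ⟨A, P, φ, q, P', φ', o, T, hA, hl, rfl⟩ |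
    ⟨C, i, d, φ, q, Us, hA, hd, hC, hU, rfl⟩
  · obtain ⟨S₂', h, h'⟩ := Program.exists_localStep_of_configLE hinv hle hA hl
    exact ⟨S₂', .single h, h'⟩
  · have hle' : Config.Rel (fun _ a a' => p.ProcEquiv a.proc a'.proc ∧ a.state = a'.state ∧
      p.QueueLE a.queue a'.queue) S S' := hle
    obtain ⟨⟨Q, ψ, q'⟩, hA', hPQ, hφ, hq⟩ := hle'.exists_of_eq_some hA
    obtain ⟨_, -, hQ⟩ := (p.procEquiv_iff _ _).1 hPQ
    obtain rfl : Q = .nil := hQ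
    obtain rfl : φ = ψ := hφ
    obtain ⟨pre, M', q'', hq', hM, hqq⟩ := Program.QueueLE.exists_of_cons hq
    obtain rfl : q' = pre ++ M' :: q'' := hq'
    obtain ⟨θ, hθ, rfl⟩ := (p.msgEquiv_iff _ _).1 hM
    obtain ⟨S₁, r, hS₁, hA₁, hg⟩ := Program.exists_consumption hc hr hb ht pre hS' hA'
    have hreach : p.Reachable S₁ := hS'.trans hS₁
    have hstep := Program.Step.inst (p := p) S₁ C i d φ (q'' ++ r) (Us.map θ) hA₁ hd hC
      (by rw [List.length_map, hU])
    refine ⟨_, hS₁.tail hstep, fun B => ?_⟩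
    rcases eq_or_ne B (.named C i) with rfl | hB
    · rw [Config.set_self, Config.set_self]
      refine .some ⟨Program.procEquiv_inst hinv (hreach.inv hc hr hb) d _ hU hθ ?_ ?_, rfl,
        hqq.append_right r⟩
      -- Fresh variables are chosen while the message is still in the queue, so its arguments count
      -- as in use.
      · exact fun x hx => ⟨_, _, hA, .inr (.inr ⟨_, List.mem_cons_self, hx⟩)⟩
      · exact fun x hx => ⟨_, _, hA₁, .inr (.inr ⟨_, List.mem_cons_self, hx⟩)⟩
    · rw [Config.set_of_ne _ hB, Config.set_of_ne _ hB]
      obtain ⟨r', hr'⟩ := hg B hB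
      have := hle B
      rw [hr']
      generalize S B = x at this ⊢
      generalize S' B = y at this ⊢
      cases this with
      | none => exact .none
      | some h => exact .some ⟨h.1, h.2.1, h.2.2.append_right r'⟩

end

end ActorLang

-- The transition system is well-structured

theorem mainTheorem3 (p : ActorLang.Program)
    (hunambiguous : p.Unambiguous) (hcorrect : p.Correct)
    (hreadOnly : p.ReadOnly) (hbounded : p.BoundedActors)
    (htypes : p.TypeSafe) :
    ActorLang.IsWSTS p.Trans p.LE where
  finitely_branching s :=
    (p.finite_step (s.2.inv hcorrect hreadOnly hbounded).finite_dom).preimage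
      Subtype.val_injective.injOn
  le_refl s := .refl p s.1
  le_trans _ _ _ := .trans
  well_quasi_ordered := ActorLang.Program.wellQuasiOrdered hcorrect hreadOnly hbounded htypes
  upward_compatible s₁ s₁' s₂ hle h := by
    obtain ⟨S, hS, hle'⟩ := ActorLang.Program.upward_compatible hcorrect hreadOnly hbounded htypes
      s₁.2 s₁'.2 hle h
    -- The computation lives on configurations; it is lifted to states by proving reachability along
    -- the way.
    suffices ∃ hS : p.Reachable S, Relation.ReflTransGen p.Trans s₁' ⟨S, hS⟩ by
      obtain ⟨hS, h⟩ := this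
      exact ⟨⟨S, hS⟩, h, hle'⟩
    clear hle'
    induction hS with
    | refl => exact ⟨s₁'.2, .refl⟩
    | tail _ h ih =>
      obtain ⟨hS, h'⟩ := ih
      exact ⟨hS.tail h, h'.tail h⟩
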